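/- **Model.** There are $n$ processes $p_0,\dots,p_{n-1}$, at most $f$ of which are Byzantine (the set $F$), and $n\ge 3f+1$. Each process acts both as a proposer and as an acceptor. They communicate by asynchronous, reliable, authenticated point-to-point links (complete graph); "broadcast" means sending to every process, including oneself. $V$ is a set of values, $E\subseteq V$ is the set of values that may be proposed, and each correct $p\notin F$ has an input $pro_p\in E$. Signatures are ideal: $\mathrm{Verify}(e)$ is true iff $e$ was returned by an earlier call of $\mathrm{Sign}$, and only $p$ signs in the name of a correct $p$. Otherwise Byzantine processes send arbitrary messages at any time. Local computation takes no time, and all correct processes start at time $0$. We say that message delays are at most $\Delta$ if every message sent by a correct process to a correct process at time $t$ is delivered by time $t+\Delta$. **Notation.** $q=\lfloor (n+f)/2\rfloor+1$. A signed value $v$ consists of a value in $V$ and its signer. Two verified signed values of the same signer with different values form a conflicting pair. $\mathrm{Conf}(S)$ is the set of conflicting pairs $(x,y)\in S\times S$, and $\mathrm{Rem}(S)$ is $S$ without the members of these pairs. A proposal is a set of pairs $\langle v,A\rangle$ of a signed value and a set $A$ of signed safe-acks; proposals are compared ($\subseteq$, $=$) through their sets of signed values $v$, the proofs $A$ being attachments.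 $\mathrm{AllSafe}(S)$ means that for every $\langle v,A\rangle\in S$: $|A|\ge q$, all elements of $A$ verify and have different signers, each contains $v$ in its received set and in no pair of its conflict set, and the value of $v$ is in $E$. **Algorithm SbS, proposer $p$.** Initially $state=init$, $ts=0$, and $Safe\_acks,Proposed\_set,Ack\_set$ and the set $byz$ are empty. * At the start: sign $pro_p$, put it in $Safety\_set$, and broadcast $\langle init,v\rangle$ with the signed value $v$. * In state $init$, on $\langle init,v\rangle$ from $s$, where $v$ is signed by $s$, verifies and has its value in $E$: $Safety\_set:=\mathrm{Rem}(Safety\_set\cup\{v\})$. * When $|Safety\_set|\ge n-f$ in state $init$: go to state $safetying$ and broadcast $\langle safe\_req,Safety\_set\rangle$. * In state $safetying$, on a message $m=\langle safe\_ack,R,C\rangle$ from $s$: if $m$ carries a valid signature of $s$, $R=Safety\_set$, and every pair in $C$ is a conflicting pair, then add $m$ to $Safe\_acks$ (at most one message per acceptor); otherwise add $s$ to $byz$. * When $|Safe\_acks|\ge q$ in state $safetying$: add $\langle v,Safe\_acks\rangle$ to $Proposed\_set$ for every $v\in Safety\_set$ that appears in no conflict set in $Safe\_acks$; go to state $proposing$,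 set $Ack\_set:=\emptyset$, $ts:=ts+1$, and broadcast $\langle ack\_req,Proposed\_set,ts\rangle$. * In state $proposing$, on $\langle ack,R,ts\rangle$ (with the current $ts$) from $s$: if $R=Proposed\_set$ and $s\notin byz$, add $s$ to $Ack\_set$; otherwise add $s$ to $byz$. * In state $proposing$, on $\langle nack,R,ts\rangle$ (with the current $ts$) from $s$: if $R\not\subseteq Proposed\_set$, $s\notin byz$ and $\mathrm{AllSafe}(R)$, then $Proposed\_set:=Proposed\_set\cup R$, $Ack\_set:=\emptyset$, $ts:=ts+1$, and broadcast $\langle ack\_req,Proposed\_set,ts\rangle$; otherwise add $s$ to $byz$. * When $|Ack\_set|\ge q$ in state $proposing$: go to state $decided$ and decide the set of values in $Proposed\_set$. **Acceptor.** Initially $SafeCandidates=Accepted\_set=\emptyset$. * On $\langle safe\_req,S\rangle$ from $s$, if all elements of $S$ verify: send $s$ the signed message $\langle safe\_ack,S,\mathrm{Conf}(S\cup SafeCandidates)\rangle$, then add $\mathrm{Rem}(S\cup SafeCandidates)$ to $SafeCandidates$. * On $\langle ack\_req,R,x\rangle$ from $s$ with $\mathrm{AllSafe}(R)$: if $Accepted\_set\subseteq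 R$, set $Accepted\_set:=R$ and send $\langle ack,R,x\rangle$ to $s$; otherwise send $\langle nack,Accepted\_set,x\rangle$ to $s$ and set $Accepted\_set:=Accepted\_set\cup R$. **Theorem.** If $n\ge 3f+1$ and $|F|\le f$, then in every execution of SbS every correct proposer decides, and it does so in at most $5+4f$ message delays: whenever message delays are at most $\Delta$, it decides by time $(5+4f)\Delta$. -/

import Mathlib

noncomputable section

open scoped Classical

namespace SbS

/-- The value `value` signed by the process `sender`. -/
structure SignedValue (n : ℕ) (V : Type*) where
  value : V
  sender : Fin n

/-- A message `<safe_ack, rcvd, conflicts>` signed by the acceptor `signer`. -/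
structure SafeAck (n : ℕ) (V : Type*) where
  signer : Fin n
  rcvd : Finset (SignedValue n V)
  conflicts : Finset (SignedValue n V × SignedValue n V)

/-- A set of pairs `<v, Acks>`: a signed value together with its proof of safety. -/
abbrev Proposal (n : ℕ) (V : Type*) := Finset (SignedValue n V × Finset (SafeAck n V))

/-- The lattice element carried by a proposal: the set of its values, without their proofs.
Proposals are compared (`≤`, `=`) through this set. -/
def Proposal.values {n : ℕ} {V : Type*} (S : Proposal n V) : Finset (SignedValue n V) :=
  S.image Prod.fst

inductive Msg (n : ℕ) (V : Type*) where
  | initPhase (x : SignedValue n V)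
  | safeReq (S : Finset (SignedValue n V))
  | safeAck (a : SafeAck n V)
  | ackReq (S : Proposal n V) (ts : ℕ)
  | ack (S : Proposal n V) (ts : ℕ)
  | nack (S : Proposal n V) (ts : ℕ)

/-- A message on the authenticated point-to-point link from `src` to `dst`. -/
structure Envelope (n : ℕ) (V : Type*) where
  src : Fin n
  dst : Fin n
  msg : Msg n V

/-- All the elements that calls to `Sign` have returned so far.
`Verify e` holds if and only if `e` is among them. -/
structure Signatures (n : ℕ) (V : Type*) where
  vals : Set (SignedValue n V)
  acks : Set (SafeAck n V)

/-! ### Helper procedures -/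

/-- `VerifyConfPair`. -/
def VerifyConfPair {n : ℕ} {V : Type*} (σ : Signatures n V)
    (c : SignedValue n V × SignedValue n V) : Prop :=
  c.1 ∈ σ.vals ∧ c.2 ∈ σ.vals ∧ c.1.sender = c.2.sender ∧ c.1.value ≠ c.2.value

/-- `ReturnConflicts`. -/
def returnConflicts {n : ℕ} {V : Type*} (σ : Signatures n V) (S : Finset (SignedValue n V)) :
    Finset (SignedValue n V × SignedValue n V) :=
  (S ×ˢ S).filter (VerifyConfPair σ)

/-- `RemoveConflicts`: every member of a conflicting pair is removed. -/
def removeConflicts {n : ℕ} {V : Type*} (σ : Signatures n V) (S : Finset (SignedValue n V)) :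
    Finset (SignedValue n V) :=
  S.filter (fun x => ∀ c ∈ returnConflicts σ S, x ≠ c.1 ∧ x ≠ c.2)

/-- The value `v` appears in some pair of the set `C`. -/
def Appears {n : ℕ} {V : Type*} (v : SignedValue n V)
    (C : Finset (SignedValue n V × SignedValue n V)) : Prop :=
  ∃ c ∈ C, c.1 = v ∨ c.2 = v

/-- `⌊(n+f)/2⌋ + 1`. -/
def quorum (n f : ℕ) : ℕ := (n + f) / 2 + 1

/-- `AllSafe`: every value of the set comes with a valid proof of safety and lies in `E`. -/
def AllSafe {n : ℕ} {V : Type*} (f : ℕ) (E : Set V) (σ : Signatures n V)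
    (S : Proposal n V) : Prop :=
  ∀ e ∈ S,
    quorum n f ≤ e.2.card ∧
    (∀ a ∈ e.2, e.1 ∈ a.rcvd) ∧
    (∀ a ∈ e.2, ¬ Appears e.1 a.conflicts) ∧
    (∀ a ∈ e.2, a ∈ σ.acks) ∧
    (∀ a ∈ e.2, ∀ b ∈ e.2, a ≠ b → a.signer ≠ b.signer) ∧
    e.1.value ∈ E

/-! ### Proposer -/

inductive Phase where
  | init
  | safetying
  | proposing
  | decided

structure ProposerState (n : ℕ) (V : Type*) where
  phase : Phase
  safetySet : Finset (SignedValue n V)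
  safeAcks : Finset (SafeAck n V)
  proposedSet : Proposal n V
  /-- The senders of the entries `(<ack, Proposed_set, ts>, sender)` of `Ack_set`; the message in
  such an entry is determined by the current `Proposed_set` and `ts`. -/
  ackSet : Finset (Fin n)
  /-- The processes `k` with `byz[k] = True`. -/
  byz : Finset (Fin n)
  ts : ℕ
  /-- The argument of `DECIDE`, if it has been called. -/
  decision : Option (Finset V)

/-- The events of the proposer that are triggered by a condition on its state. They are executed
as soon as their condition holds, that is, at the end of the handler that makes it true; no
execution of one of them makes the condition of another one true. The second component lists the
messages that are broadcast to all processes. -/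
def trigger {n : ℕ} {V : Type*} (f : ℕ) (st : ProposerState n V) :
    ProposerState n V × List (Msg n V) :=
  match st.phase with
  | .init =>
    if n - f ≤ st.safetySet.card then
      ({ st with phase := .safetying }, [.safeReq st.safetySet])
    else (st, [])
  | .safetying =>
    if quorum n f ≤ st.safeAcks.card then
      let P : Proposal n V := st.proposedSet ∪
        (st.safetySet.filter (fun v => ∀ a ∈ st.safeAcks, ¬ Appears v a.conflicts)).image
          (fun v => (v, st.safeAcks))
      ({ st with phase := .proposing, proposedSet := P, ackSet := ∅, ts := st.ts + 1 },
        [.ackReq P (st.ts + 1)])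
    else (st, [])
  | .proposing =>
    if quorum n f ≤ st.ackSet.card then
      ({ st with
          phase := .decided
          decision := some (st.proposedSet.values.image SignedValue.value) }, [])
    else (st, [])
  | .decided => (st, [])

/-- The handlers of the proposer for the delivery of a message from `src`. At most one `safe_ack`
per acceptor is kept. -/
def proposerHandle {n : ℕ} {V : Type*} (f : ℕ) (E : Set V) (σ : Signatures n V)
    (st : ProposerState n V) (src : Fin n) (m : Msg n V) :
    ProposerState n V × List (Msg n V) :=
  match st.phase, m with
  | .init, .initPhase x =>
    if x.sender = src ∧ x ∈ σ.vals ∧ x.value ∈ E then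
      ({ st with safetySet := removeConflicts σ (insert x st.safetySet) }, [])
    else (st, [])
  | .safetying, .safeAck a =>
    if a.signer = src ∧ a ∈ σ.acks ∧ a.rcvd = st.safetySet ∧
        ∀ c ∈ a.conflicts, VerifyConfPair σ c then
      if ∃ b ∈ st.safeAcks, b.signer = src then (st, [])
      else ({ st with safeAcks := insert a st.safeAcks }, [])
    else ({ st with byz := insert src st.byz }, [])
  | .proposing, .ack S rts =>
    if rts = st.ts then
      if st.proposedSet.values = S.values ∧ src ∉ st.byz then
        ({ st with ackSet := insert src st.ackSet }, [])
      else ({ st with byz := insert src st.byz }, [])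
    else (st, [])
  | .proposing, .nack S rts =>
    if rts = st.ts then
      if st.proposedSet.values ≠ S.values ∪ st.proposedSet.values ∧ src ∉ st.byz ∧
          AllSafe f E σ S then
        ({ st with proposedSet := S ∪ st.proposedSet, ackSet := ∅, ts := st.ts + 1 },
          [.ackReq (S ∪ st.proposedSet) (st.ts + 1)])
      else ({ st with byz := insert src st.byz }, [])
    else (st, [])
  | _, _ => (st, [])

/-- The whole reaction of the proposer to a delivery: the handler, then the condition events. -/
def proposerReceive {n : ℕ} {V : Type*} (f : ℕ) (E : Set V) (σ : Signatures n V)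
    (st : ProposerState n V) (src : Fin n) (m : Msg n V) :
    ProposerState n V × List (Msg n V) :=
  let r := proposerHandle f E σ st src m
  let t := trigger f r.1
  (t.1, r.2 ++ t.2)

/-- The initial values of the variables, after `p` has signed its input `v` and put it in its
`Safety_set`. -/
def proposerStart {n : ℕ} {V : Type*} (p : Fin n) (v : V) : ProposerState n V where
  phase := .init
  safetySet := {⟨v, p⟩}
  safeAcks := ∅
  proposedSet := ∅
  ackSet := ∅
  byz := ∅
  ts := 0
  decision := none

/-! ### Acceptor -/

structure AcceptorState (n : ℕ) (V : Type*) where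
  safeCandidates : Finset (SignedValue n V)
  accepted : Proposal n V

/-- The reaction of the acceptor `p` to a delivery. The second component lists the messages sent
back to the sender. -/
def acceptorReceive {n : ℕ} {V : Type*} (f : ℕ) (E : Set V) (σ : Signatures n V) (p : Fin n)
    (st : AcceptorState n V) (m : Msg n V) : AcceptorState n V × List (Msg n V) :=
  match m with
  | .safeReq S =>
    if ∀ x ∈ S, x ∈ σ.vals then
      ({ st with safeCandidates :=
          st.safeCandidates ∪ removeConflicts σ (S ∪ st.safeCandidates) },
        [.safeAck ⟨p, S, returnConflicts σ (S ∪ st.safeCandidates)⟩])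
    else (st, [])
  | .ackReq S x =>
    if AllSafe f E σ S then
      if st.accepted.values ⊆ S.values then
        ({ st with accepted := S }, [.ack S x])
      else
        ({ st with accepted := S ∪ st.accepted }, [.nack st.accepted x])
    else (st, [])
  | _ => (st, [])

/-! ### Executions

Every process is a proposer and an acceptor. `F` is the set of Byzantine processes. -/

structure Config (n : ℕ) (V : Type*) where
  proposer : Fin n → ProposerState n V
  acceptor : Fin n → AcceptorState n V
  sigs : Signatures n V

inductive Event (n : ℕ) (V : Type*) where
  /-- The delivery of a message. -/
  | deliver (e : Envelope n V)
  /-- A Byzantine process signs a value. -/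
  | signValue (x : SignedValue n V)
  /-- A Byzantine process signs a `safe_ack`. -/
  | signAck (a : SafeAck n V)
  /-- Nothing happens. -/
  | idle

/-- The configuration in which every correct process has just proposed its input. The states of
Byzantine processes play no role. -/
def initialConfig {n : ℕ} {V : Type*} (f : ℕ) (F : Finset (Fin n)) (pro : Fin n → V) :
    Config n V where
  proposer p := (trigger f (proposerStart p (pro p))).1
  acceptor _ := ⟨∅, ∅⟩
  sigs := ⟨{x | x.sender ∉ F ∧ x.value = pro x.sender}, ∅⟩

/-- The messages that correct processes send at the start. -/
def initialMsgs {n : ℕ} {V : Type*} (f : ℕ) (F : Finset (Fin n)) (pro : Fin n → V) :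
    Set (Envelope n V) :=
  {e | e.src ∉ F ∧ e.msg ∈
    .initPhase ⟨pro e.src, e.src⟩ :: (trigger f (proposerStart e.src (pro e.src))).2}

/-- The configuration after an event. -/
def next {n : ℕ} {V : Type*} (f : ℕ) (E : Set V) (F : Finset (Fin n)) (c : Config n V) :
    Event n V → Config n V
  | .deliver e =>
    if e.dst ∈ F then c
    else
      let P := proposerReceive f E c.sigs (c.proposer e.dst) e.src e.msg
      let A := acceptorReceive f E c.sigs e.dst (c.acceptor e.dst) e.msg
      { proposer := Function.update c.proposer e.dst P.1
        acceptor := Function.update c.acceptor e.dst A.1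
        sigs := ⟨c.sigs.vals, c.sigs.acks ∪ {a | Msg.safeAck a ∈ A.2}⟩ }
  | .signValue x => { c with sigs := ⟨insert x c.sigs.vals, c.sigs.acks⟩ }
  | .signAck a => { c with sigs := ⟨c.sigs.vals, insert a c.sigs.acks⟩ }
  | .idle => c

/-- The messages that a correct process sends during an event: the broadcasts of its proposer part
and the replies of its acceptor part. -/
def emitted {n : ℕ} {V : Type*} (f : ℕ) (E : Set V) (F : Finset (Fin n)) (c : Config n V) :
    Event n V → Set (Envelope n V)
  | .deliver e =>
    {e' | e.dst ∉ F ∧ e'.src = e.dst ∧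
      (e'.msg ∈ (proposerReceive f E c.sigs (c.proposer e.dst) e.src e.msg).2 ∨
        (e'.dst = e.src ∧
          e'.msg ∈ (acceptorReceive f E c.sigs e.dst (c.acceptor e.dst) e.msg).2))}
  | _ => ∅

/-- Executions of SbS in an asynchronous system in which the processes of `F` are Byzantine and the
input of each correct process `p` is `pro p`. The `k`-th event takes place at time `time k` in the
configuration `config k`; the start is at time `0` and local computation takes no time. Byzantine
processes sign whatever they want in their own name and send arbitrary messages at any time. -/
structure Execution {n : ℕ} {V : Type*} (f : ℕ) (E : Set V) (F : Finset (Fin n))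
    (pro : Fin n → V) where
  config : ℕ → Config n V
  event : ℕ → Event n V
  time : ℕ → ℝ
  config_zero : config 0 = initialConfig f F pro
  config_succ : ∀ k, config (k + 1) = next f E F (config k) (event k)
  time_nonneg : ∀ k, 0 ≤ time k
  time_mono : Monotone time
  /-- Links are authenticated: a message delivered from a correct process was sent by it. -/
  authentic : ∀ k e, event k = .deliver e → e.src ∉ F →
    e ∈ initialMsgs f F pro ∨ ∃ j < k, e ∈ emitted f E F (config j) (event j)
  /-- Signatures of correct processes cannot be forged. -/
  signValue_byz : ∀ k x, event k = .signValue x → x.sender ∈ F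
  signAck_byz : ∀ k a, event k = .signAck a → a.signer ∈ F
  /-- Links are reliable: messages between correct processes are eventually delivered. -/
  reliable_init : ∀ e ∈ initialMsgs f F pro, e.dst ∉ F → ∃ j, event j = .deliver e
  reliable : ∀ k, ∀ e ∈ emitted f E F (config k) (event k), e.dst ∉ F →
    ∃ j > k, event j = .deliver e

namespace Execution

variable {n : ℕ} {V : Type*} {f : ℕ} {E : Set V} {F : Finset (Fin n)} {pro : Fin n → V}

/-- Every message between correct processes is delivered at most `Δ` after it was sent: `Δ` is
(an upper bound on) one message delay. -/
def DelaysAtMost (X : Execution f E F pro) (Δ : ℝ) : Prop :=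
  (∀ e ∈ initialMsgs f F pro, e.dst ∉ F → ∃ j, X.event j = .deliver e ∧ X.time j ≤ Δ) ∧
  ∀ k, ∀ e ∈ emitted f E F (X.config k) (X.event k), e.dst ∉ F →
    ∃ j > k, X.event j = .deliver e ∧ X.time j ≤ X.time k + Δ

/-- The process `p` decides (calls `DECIDE`) during the `k`-th event. -/
def DecidesAt (X : Execution f E F pro) (p : Fin n) (k : ℕ) : Prop :=
  ((X.config k).proposer p).decision = none ∧
    ∃ D : Finset V, ((X.config (k + 1)).proposer p).decision = some D

end Execution

end SbS

end

/-! A potential argument bounds the number of proposals. The first proposal of a correct proposer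
has at least `n - 2f` values: `Safety_set` holds at least `n - f` values of different senders, and
only values signed by Byzantine processes, at most `f` of them, can lie in a verified conflicting
pair (`ProposerInv.first_proposal_card`). A safe proposal has at most `n` values
(`AllSafe.card_values_le`): proofs of safety for two different values of one signer would share a
correct acceptor, and a correct acceptor flags at least one of two conflicting values it
acknowledges (`acceptorReceive_inv`). Each accepted nack adds a value, so `ts` never exceeds `2f +
1`.

For progress, the correct processes alone form a quorum, and a correct proposer never distrusts one
of them, because their answers always pass its tests (`IsAnswer`, `proposerHandle_inv`). Once all of
them have answered the current request, either a nack has produced a new proposal or a quorum of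
acks has produced a decision (`Deadline.exists_refined`). The phases cost one delay for `init`, two
for `safetying` and two for each of at most `2f + 1` proposals: `1 + 2 + 2(2f + 1) = 5 + 4f`.

The facts about states and messages are proved as one inductive invariant, `Execution.Inv`.
Termination is then proved over an abstract predicate `B r j`; the constantly true predicate gives
eventual decision, and `time j ≤ r * Δ` gives the time bound. -/

noncomputable section

open scoped Classical

namespace SbS

variable {n : ℕ} {V : Type*} {f : ℕ} {E : Set V} {F : Finset (Fin n)} {pro : Fin n → V}

/-! ### Signatures and safety proofs -/

/-- Every element signed in `σ` is signed in `τ`. -/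
structure Signatures.Le (σ τ : Signatures n V) : Prop where
  vals : σ.vals ⊆ τ.vals
  acks : σ.acks ⊆ τ.acks

theorem Signatures.Le.refl (σ : Signatures n V) : σ.Le σ := ⟨subset_rfl, subset_rfl⟩

/-- The only value signed by a correct process is its input. -/
structure Signatures.Genuine (F : Finset (Fin n)) (pro : Fin n → V) (σ : Signatures n V) :
    Prop where
  value_eq : ∀ x ∈ σ.vals, x.sender ∉ F → x.value = pro x.sender
  input_mem : ∀ s, s ∉ F → (⟨pro s, s⟩ : SignedValue n V) ∈ σ.vals

theorem SignedValue.eq_of {x y : SignedValue n V} (hs : x.sender = y.sender)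
    (hv : x.value = y.value) : x = y := by
  cases x; cases y; simp_all

theorem VerifyConfPair.mono {σ τ : Signatures n V} (h : σ.Le τ)
    {c : SignedValue n V × SignedValue n V} (hc : VerifyConfPair σ c) : VerifyConfPair τ c :=
  ⟨h.vals hc.1, h.vals hc.2.1, hc.2.2⟩

/-- A correct process signs only its input, so two different values in one name expose a Byzantine
signer. No forged report can therefore discredit a correct input. -/
theorem VerifyConfPair.sender_mem {σ : Signatures n V} (hσ : σ.Genuine F pro)
    {c : SignedValue n V × SignedValue n V} (hc : VerifyConfPair σ c) :
    c.1.sender ∈ F ∧ c.2.sender ∈ F := by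
  obtain ⟨h1, h2, hs, hv⟩ := hc
  have : c.1.sender ∈ F := by
    by_contra hF
    exact hv (by rw [hσ.value_eq _ h1 hF, hσ.value_eq _ h2 (hs ▸ hF), hs])
  exact ⟨this, hs ▸ this⟩

theorem mem_returnConflicts {σ : Signatures n V} {S : Finset (SignedValue n V)}
    {c : SignedValue n V × SignedValue n V} :
    c ∈ returnConflicts σ S ↔ (c.1 ∈ S ∧ c.2 ∈ S) ∧ VerifyConfPair σ c := by
  simp [returnConflicts]

theorem mem_removeConflicts {σ : Signatures n V} {S : Finset (SignedValue n V)}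
    {x : SignedValue n V} :
    x ∈ removeConflicts σ S ↔ x ∈ S ∧ ¬ Appears x (returnConflicts σ S) := by
  simp only [removeConflicts, Finset.mem_filter, Appears, not_exists, not_and, not_or,
    eq_comm (a := x), ne_eq]

theorem mem_removeConflicts_of_correct {σ : Signatures n V} (hσ : σ.Genuine F pro)
    {S : Finset (SignedValue n V)} {x : SignedValue n V} (hx : x ∈ S) (hF : x.sender ∉ F) :
    x ∈ removeConflicts σ S := by
  refine mem_removeConflicts.2 ⟨hx, ?_⟩
  rintro ⟨c, hc, h⟩
  have := (mem_returnConflicts.1 hc).2.sender_mem hσ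
  rcases h with rfl | rfl
  exacts [hF this.1, hF this.2]

theorem removeConflicts_value_eq {σ : Signatures n V} {S : Finset (SignedValue n V)}
    (hS : ∀ x ∈ S, x ∈ σ.vals) {x y : SignedValue n V} (hx : x ∈ removeConflicts σ S)
    (hy : y ∈ removeConflicts σ S) (h : x.sender = y.sender) : x.value = y.value := by
  rw [mem_removeConflicts] at hx hy
  by_contra hne
  exact hx.2 ⟨(x, y), mem_returnConflicts.2 ⟨⟨hx.1, hy.1⟩, hS _ hx.1, hS _ hy.1, h, hne⟩, .inl rfl⟩

theorem AllSafe.mono {σ τ : Signatures n V} (h : σ.Le τ) {S : Proposal n V}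
    (hS : AllSafe f E σ S) : AllSafe f E τ S := fun e he =>
  let ⟨h1, h2, h3, h4, h5⟩ := hS e he
  ⟨h1, h2, h3, fun a ha => h.acks (h4 a ha), h5⟩

theorem AllSafe.union {σ : Signatures n V} {S T : Proposal n V} (hS : AllSafe f E σ S)
    (hT : AllSafe f E σ T) : AllSafe f E σ (S ∪ T) := fun e he =>
  (Finset.mem_union.1 he).elim (hS e) (hT e)

theorem allSafe_empty {σ : Signatures n V} : AllSafe f E σ (∅ : Proposal n V) :=
  fun _ he => absurd he (Finset.notMem_empty _)

theorem Proposal.values_union (S T : Proposal n V) :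
    Proposal.values (S ∪ T) = S.values ∪ T.values := Finset.image_union _ _

/-- From `3f < n` follows `n + f < 2(n - f)`, so correct processes alone form a quorum. This is the
only place where the bound on `n` does any work. -/
theorem quorum_le (hn : 3 * f + 1 ≤ n) (hF : F.card ≤ f) : quorum n f ≤ n - F.card := by
  unfold quorum; omega

theorem card_correct (F : Finset (Fin n)) : (Finset.univ \ F).card = n - F.card := by
  rw [Finset.card_sdiff_of_subset (Finset.subset_univ _), Finset.card_univ, Fintype.card_fin]

/-- Two quorums of signers share a correct process. -/
theorem exists_common_signer (hF : F.card ≤ f) {A B : Finset (SafeAck n V)}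
    (hA : quorum n f ≤ A.card) (hB : quorum n f ≤ B.card)
    (hA' : ∀ a ∈ A, ∀ b ∈ A, a ≠ b → a.signer ≠ b.signer)
    (hB' : ∀ a ∈ B, ∀ b ∈ B, a ≠ b → a.signer ≠ b.signer) :
    ∃ a ∈ A, ∃ b ∈ B, a.signer = b.signer ∧ a.signer ∉ F := by
  have cA : (A.image SafeAck.signer).card = A.card :=
    Finset.card_image_of_injOn fun a ha b hb h => by_contra fun hne => hA' a ha b hb hne h
  have cB : (B.image SafeAck.signer).card = B.card :=
    Finset.card_image_of_injOn fun a ha b hb h => by_contra fun hne => hB' a ha b hb hne h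
  have hu := Finset.card_union_add_card_inter (A.image SafeAck.signer) (B.image SafeAck.signer)
  have hle := Finset.card_le_univ (A.image SafeAck.signer ∪ B.image SafeAck.signer)
  rw [Fintype.card_fin] at hle
  -- Twice the quorum is at least `n + f + 1`, so the overlap has more than `f` signers.
  have hlt : F.card < (A.image SafeAck.signer ∩ B.image SafeAck.signer).card := by
    unfold quorum at hA hB; omega
  obtain ⟨s, hs, hsF⟩ := Finset.exists_mem_notMem_of_card_lt_card hlt
  simp only [Finset.mem_inter, Finset.mem_image] at hs
  obtain ⟨⟨a, ha, rfl⟩, b, hb, hab⟩ := hs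
  exact ⟨a, ha, b, hb, hab.symm, hsF⟩

/-! ### Local steps of the acceptor -/

/-- Conflicting values are never both acknowledged as free of conflicts by the process `s`. -/
structure AcceptorInv (f : ℕ) (E : Set V) (σ : Signatures n V) (s : Fin n)
    (st : AcceptorState n V) : Prop where
  candidates_signed : ∀ x ∈ st.safeCandidates, x ∈ σ.vals
  accepted_safe : AllSafe f E σ st.accepted
  rcvd_signed : ∀ a ∈ σ.acks, a.signer = s → ∀ x ∈ a.rcvd, x ∈ σ.vals
  rcvd_candidate : ∀ a ∈ σ.acks, a.signer = s → ∀ x ∈ a.rcvd,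
    Appears x a.conflicts ∨ x ∈ st.safeCandidates
  conflict : ∀ a ∈ σ.acks, a.signer = s → ∀ b ∈ σ.acks, b.signer = s → ∀ x ∈ a.rcvd,
    ∀ y ∈ b.rcvd, x.sender = y.sender → x.value ≠ y.value →
      Appears x a.conflicts ∨ Appears y b.conflicts

/-- The state of an acceptor stays consistent when other signatures are added. -/
theorem AcceptorInv.mono {σ τ : Signatures n V} {s : Fin n} {st : AcceptorState n V}
    (h : AcceptorInv f E σ s st) (hle : σ.Le τ)
    (hs : ∀ a ∈ τ.acks, a.signer = s → a ∈ σ.acks) : AcceptorInv f E τ s st where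
  candidates_signed x hx := hle.vals (h.candidates_signed x hx)
  accepted_safe := h.accepted_safe.mono hle
  rcvd_signed a ha has x hx := hle.vals (h.rcvd_signed a (hs a ha has) has x hx)
  rcvd_candidate a ha has := h.rcvd_candidate a (hs a ha has) has
  conflict a ha has b hb hbs := h.conflict a (hs a ha has) has b (hs b hb hbs) hbs

/-- The acceptor remembers every received value that it does not flag. A later conflicting value is
compared with that memory and flagged, so the field `rcvd_candidate` is what makes `conflict`
inductive. -/
theorem acceptorReceive_inv {σ : Signatures n V} {s : Fin n} {st : AcceptorState n V}
    (h : AcceptorInv f E σ s st) (m : Msg n V) :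
    AcceptorInv f E
      ⟨σ.vals, σ.acks ∪ {a | Msg.safeAck a ∈ (acceptorReceive f E σ s st m).2}⟩ s
      (acceptorReceive f E σ s st m).1 := by
  have hle : ∀ A : Set (SafeAck n V), σ.Le ⟨σ.vals, σ.acks ∪ A⟩ :=
    fun A => ⟨subset_rfl, Set.subset_union_left⟩
  cases m with
  | safeReq S =>
    by_cases hS : ∀ x ∈ S, x ∈ σ.vals
    · simp only [acceptorReceive, if_pos hS, List.mem_singleton, Msg.safeAck.injEq,
        Set.ofPred_eq_eq_singleton]
      set C := returnConflicts σ (S ∪ st.safeCandidates) with hC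
      have hU : ∀ x ∈ S ∪ st.safeCandidates, x ∈ σ.vals := fun x hx =>
        (Finset.mem_union.1 hx).elim (hS x) (h.candidates_signed x)
      have key : ∀ x ∈ S ∪ st.safeCandidates, ∀ y ∈ S ∪ st.safeCandidates,
          x.sender = y.sender → x.value ≠ y.value → Appears x C ∧ Appears y C :=
        fun x hx y hy hs hv =>
          have := mem_returnConflicts.2 ⟨⟨hx, hy⟩, hU x hx, hU y hy, hs, hv⟩
          ⟨⟨(x, y), this, .inl rfl⟩, ⟨(x, y), this, .inr rfl⟩⟩
      refine ⟨?_, h.accepted_safe.mono (hle _), ?_, ?_, ?_⟩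
      · intro x hx
        rcases Finset.mem_union.1 hx with hx | hx
        exacts [h.candidates_signed x hx, hU x (mem_removeConflicts.1 hx).1]
      · rintro a (ha | rfl) has x hx
        exacts [h.rcvd_signed a ha has x hx, hS x hx]
      · rintro a (ha | rfl) has x hx
        · exact (h.rcvd_candidate a ha has x hx).imp_right (Finset.mem_union_left _)
        · by_cases hx' : Appears x C
          · exact .inl hx'
          · exact .inr (Finset.mem_union_right _
              (mem_removeConflicts.2 ⟨Finset.mem_union_left _ hx, hx'⟩))
      -- In the mixed cases the value of the old message was flagged then or is still a candidate; a
      -- candidate makes the new message flag the other value.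
      · rintro a (ha | rfl) has b (hb | rfl) hbs x hx y hy hs hv
        · exact h.conflict a ha has b hb hbs x hx y hy hs hv
        · refine (h.rcvd_candidate a ha has x hx).imp_right fun hx' => ?_
          exact (key x (Finset.mem_union_right _ hx') y (Finset.mem_union_left _ hy) hs hv).2
        · refine (h.rcvd_candidate b hb hbs y hy).symm.imp_left fun hy' => ?_
          exact (key x (Finset.mem_union_left _ hx) y (Finset.mem_union_right _ hy') hs hv).1
        · exact .inl
            (key x (Finset.mem_union_left _ hx) y (Finset.mem_union_left _ hy) hs hv).1
    · simp only [acceptorReceive, if_neg hS]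
      exact h.mono (hle _) (by simp +contextual)
  | ackReq S x =>
    by_cases hS : AllSafe f E σ S
    · by_cases hA : st.accepted.values ⊆ S.values
      · simp only [acceptorReceive, if_pos hS, if_pos hA]
        exact { h.mono (hle _) (by simp +contextual) with accepted_safe := hS.mono (hle _) }
      · simp only [acceptorReceive, if_pos hS, if_neg hA]
        exact { h.mono (hle _) (by simp +contextual) with
          accepted_safe := (hS.union h.accepted_safe).mono (hle _) }
    · simp only [acceptorReceive, if_neg hS]
      exact h.mono (hle _) (by simp +contextual)
  | _ => exact h.mono (hle _) (by simp +contextual [acceptorReceive])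

theorem acceptorReceive_signer {σ : Signatures n V} {s : Fin n} {st : AcceptorState n V}
    {m : Msg n V} {a : SafeAck n V} (h : Msg.safeAck a ∈ (acceptorReceive f E σ s st m).2) :
    a.signer = s := by
  cases m <;> simp only [acceptorReceive] at h <;> (try split_ifs at h) <;> simp_all

theorem mem_acceptorReceive {σ : Signatures n V} {s : Fin n} {st : AcceptorState n V}
    {m m' : Msg n V} (h : m' ∈ (acceptorReceive f E σ s st m).2) :
    (∃ S, m = .safeReq S ∧
      m' = .safeAck ⟨s, S, returnConflicts σ (S ∪ st.safeCandidates)⟩) ∨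
    (∃ S x, m = .ackReq S x ∧ m' = .ack S x) ∨
    ∃ S x, m = .ackReq S x ∧ ¬ st.accepted.values ⊆ S.values ∧ m' = .nack st.accepted x := by
  cases m <;> simp only [acceptorReceive] at h <;> (try split_ifs at h) <;> simp_all

theorem acceptorReceive_safeReq {σ : Signatures n V} (s : Fin n) (st : AcceptorState n V)
    {S : Finset (SignedValue n V)} (hS : ∀ x ∈ S, x ∈ σ.vals) :
    ∃ C, Msg.safeAck ⟨s, S, C⟩ ∈ (acceptorReceive f E σ s st (.safeReq S)).2 := by
  simp only [acceptorReceive, if_pos hS]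
  exact ⟨_, List.mem_singleton_self _⟩

theorem acceptorReceive_ackReq {σ : Signatures n V} (s : Fin n) (st : AcceptorState n V)
    {S : Proposal n V} (x : ℕ) (hS : AllSafe f E σ S) :
    Msg.ack S x ∈ (acceptorReceive f E σ s st (.ackReq S x)).2 ∨
      ∃ T, Msg.nack T x ∈ (acceptorReceive f E σ s st (.ackReq S x)).2 := by
  by_cases hA : st.accepted.values ⊆ S.values
  · simp [acceptorReceive, hS, hA]
  · simp [acceptorReceive, hS, hA]

/-- The values of a safe proposal have different senders. -/
theorem AllSafe.card_values_le (hF : F.card ≤ f) {σ : Signatures n V}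
    {st : Fin n → AcceptorState n V} (hacc : ∀ s, s ∉ F → AcceptorInv f E σ s (st s))
    {S : Proposal n V} (hS : AllSafe f E σ S) : S.values.card ≤ n := by
  have hinj : Set.InjOn SignedValue.sender (S.values : Set (SignedValue n V)) := by
    intro x hx y hy hxy
    refine SignedValue.eq_of hxy (by_contra fun hv => ?_)
    simp only [Proposal.values, Finset.coe_image, Set.mem_image, Finset.mem_coe] at hx hy
    obtain ⟨⟨x, A⟩, hA, rfl⟩ := hx
    obtain ⟨⟨y, B⟩, hB, rfl⟩ := hy
    obtain ⟨cA, rA, nA, sA, dA, -⟩ := hS _ hA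
    obtain ⟨cB, rB, nB, sB, dB, -⟩ := hS _ hB
    -- This correct acceptor would have acknowledged both values and flagged neither.
    obtain ⟨a, ha, b, hb, hab, haF⟩ := exists_common_signer hF cA cB dA dB
    rcases (hacc _ haF).conflict a (sA a ha) rfl b (sB b hb) hab.symm x (rA a ha) y (rB b hb)
      hxy hv with h | h
    exacts [nA a ha h, nB b hb h]
  rw [← Finset.card_image_of_injOn hinj]
  simpa using Finset.card_le_univ (S.values.image SignedValue.sender)

/-! ### Local steps of the proposer -/

/-- The phases in the order in which a proposer passes through them. -/
def Phase.rank : Phase → ℕ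
  | .init => 0
  | .safetying => 1
  | .proposing => 2
  | .decided => 3

/-- How the state of a proposer may evolve. -/
structure ProposerState.Advance (F : Finset (Fin n)) (st st' : ProposerState n V) : Prop where
  rank : st.phase.rank ≤ st'.phase.rank
  safetySet_eq : 1 ≤ st.phase.rank → st'.safetySet = st.safetySet
  safetySet_correct : st'.phase.rank = 0 → ∀ x ∈ st.safetySet, x.sender ∉ F → x ∈ st'.safetySet
  safeAcks : st.safeAcks ⊆ st'.safeAcks
  ts : st.ts < st'.ts ∨
    st'.ts = st.ts ∧ st'.proposedSet = st.proposedSet ∧ st.ackSet ⊆ st'.ackSet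

theorem ProposerState.Advance.refl (st : ProposerState n V) : st.Advance F st :=
  ⟨le_rfl, fun _ => rfl, fun _ _ hx _ => hx, subset_rfl, .inr ⟨rfl, rfl, subset_rfl⟩⟩

theorem ProposerState.Advance.trans {s t u : ProposerState n V} (h : s.Advance F t)
    (h' : t.Advance F u) : s.Advance F u where
  rank := h.rank.trans h'.rank
  safetySet_eq hs := (h'.safetySet_eq (hs.trans h.rank)).trans (h.safetySet_eq hs)
  safetySet_correct hu x hx hF :=
    have := h'.rank
    h'.safetySet_correct hu x (h.safetySet_correct (by omega) x hx hF) hF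
  safeAcks := h.safeAcks.trans h'.safeAcks
  ts := by
    rcases h.ts with h1 | ⟨h1, h2, h3⟩ <;> rcases h'.ts with h4 | ⟨h4, h5, h6⟩
    · exact .inl (h1.trans h4)
    · exact .inl (h4 ▸ h1)
    · exact .inl (h1 ▸ h4)
    · exact .inr ⟨h4.trans h1, h5.trans h2, h3.trans h6⟩

theorem ProposerState.Advance.ts_le {s t : ProposerState n V} (h : s.Advance F t) :
    s.ts ≤ t.ts := by
  rcases h.ts with h | h <;> omega

theorem trigger_advance (st : ProposerState n V) : st.Advance F (trigger f st).1 := by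
  unfold trigger
  split <;> rename_i hp <;> try split_ifs
  all_goals first
    | exact .refl st
    | refine ⟨?_, fun _ => rfl, fun _ _ hx _ => hx, subset_rfl, ?_⟩ <;> simp [hp, Phase.rank]

theorem proposerHandle_advance {σ : Signatures n V} (hσ : σ.Genuine F pro)
    (st : ProposerState n V) (src : Fin n) (m : Msg n V) :
    st.Advance F (proposerHandle f E σ st src m).1 := by
  unfold proposerHandle
  split <;> rename_i hp <;> try split_ifs
  · refine ⟨le_rfl, fun h => ?_, fun _ x hx hF => ?_, subset_rfl, .inr ⟨rfl, rfl, subset_rfl⟩⟩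
    · simp [hp, Phase.rank] at h
    · exact mem_removeConflicts_of_correct hσ (Finset.mem_insert_of_mem hx) hF
  all_goals first
    | exact .refl st
    | refine ⟨?_, fun _ => rfl, fun _ _ hx _ => hx, ?_, ?_⟩ <;> simp [hp, Phase.rank]

theorem proposerReceive_advance {σ : Signatures n V} (hσ : σ.Genuine F pro)
    (st : ProposerState n V) (src : Fin n) (m : Msg n V) :
    st.Advance F (proposerReceive f E σ st src m).1 :=
  (proposerHandle_advance hσ st src m).trans (trigger_advance _)

/-! ### Invariant of a single proposer -/

/-- The facts about the local state of a correct proposer. -/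
structure ProposerInv (f : ℕ) (E : Set V) (F : Finset (Fin n)) (σ : Signatures n V)
    (st : ProposerState n V) : Prop where
  safety_signed : ∀ x ∈ st.safetySet, x ∈ σ.vals
  safety_mem : ∀ x ∈ st.safetySet, x.value ∈ E
  safety_inj : ∀ x ∈ st.safetySet, ∀ y ∈ st.safetySet, x.sender = y.sender → x.value = y.value
  safety_card : 1 ≤ st.phase.rank → n - f ≤ st.safetySet.card
  acks : ∀ a ∈ st.safeAcks,
    a ∈ σ.acks ∧ a.rcvd = st.safetySet ∧ ∀ c ∈ a.conflicts, VerifyConfPair σ c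
  acks_inj : ∀ a ∈ st.safeAcks, ∀ b ∈ st.safeAcks, a ≠ b → a.signer ≠ b.signer
  acks_init : st.phase.rank = 0 → st.safeAcks = ∅
  byz : st.byz ⊆ F
  early : st.phase.rank ≤ 1 → st.proposedSet = ∅ ∧ st.ts = 0
  safe : AllSafe f E σ st.proposedSet
  growth : 2 ≤ st.phase.rank → 1 ≤ st.ts ∧ n + st.ts ≤ st.proposedSet.values.card + 1 + 2 * f
  decision : st.decision = none ↔ st.phase.rank ≤ 2

theorem ProposerInv.mono {σ τ : Signatures n V} {st : ProposerState n V}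
    (h : ProposerInv f E F σ st) (hle : σ.Le τ) : ProposerInv f E F τ st :=
  { h with
    safety_signed := fun x hx => hle.vals (h.safety_signed x hx)
    acks := fun a ha =>
      let ⟨h1, h2, h3⟩ := h.acks a ha
      ⟨hle.acks h1, h2, fun c hc => (h3 c hc).mono hle⟩
    safe := h.safe.mono hle }

/-- No condition event is enabled. -/
structure ProposerState.Settled (f : ℕ) (st : ProposerState n V) : Prop where
  init : st.phase.rank = 0 → st.safetySet.card < n - f
  safetying : st.phase.rank = 1 → st.safeAcks.card < quorum n f
  proposing : st.phase.rank = 2 → st.ackSet.card < quorum n f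

theorem proposerStart_inv {σ : Signatures n V} (hσ : σ.Genuine F pro) {p : Fin n} (hp : p ∉ F)
    (hpro : pro p ∈ E) : ProposerInv f E F σ (proposerStart p (pro p)) := by
  constructor <;> simp [proposerStart, Phase.rank, hpro, allSafe_empty, hσ.input_mem p hp]

/-- Values of correct processes are never removed from the first proposal. -/
theorem ProposerInv.first_proposal_card {σ : Signatures n V} (hσ : σ.Genuine F pro)
    (hF : F.card ≤ f) {st : ProposerState n V} (h : ProposerInv f E F σ st)
    (hr : 1 ≤ st.phase.rank) :
    n ≤ (st.safetySet.filter fun v => ∀ a ∈ st.safeAcks, ¬ Appears v a.conflicts).card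
      + 2 * f := by
  -- Senders in the safety set are pairwise different, so Byzantine processes own at most `f` of its
  -- values.
  have h1 : (st.safetySet.filter fun v => v.sender ∈ F).card ≤ F.card := by
    refine Finset.card_le_card_of_injOn SignedValue.sender (fun x hx => ?_) fun x hx y hy hxy => ?_
    · exact (Finset.mem_filter.1 hx).2
    · exact SignedValue.eq_of hxy
        (h.safety_inj x (Finset.mem_filter.1 hx).1 y (Finset.mem_filter.1 hy).1 hxy)
  have h2 : (st.safetySet.filter fun v => ¬ v.sender ∈ F).card ≤
      (st.safetySet.filter fun v => ∀ a ∈ st.safeAcks, ¬ Appears v a.conflicts).card := by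
    refine Finset.card_le_card fun x hx => ?_
    rw [Finset.mem_filter] at hx ⊢
    refine ⟨hx.1, fun a ha => ?_⟩
    rintro ⟨c, hc, hcx⟩
    have := ((h.acks a ha).2.2 c hc).sender_mem hσ
    rcases hcx with rfl | rfl
    exacts [hx.2 this.1, hx.2 this.2]
  have h3 := Finset.card_filter_add_card_filter_not (s := st.safetySet) (fun v => v.sender ∈ F)
  have h4 := h.safety_card hr
  omega

/-- One firing suffices: on entry to `safetying` and `proposing` the relevant set of
acknowledgements is empty, while a quorum is positive. -/
theorem trigger_inv {σ : Signatures n V} (hσ : σ.Genuine F pro) (hF : F.card ≤ f)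
    {st : ProposerState n V} (h : ProposerInv f E F σ st) :
    ProposerInv f E F σ (trigger f st).1 ∧ (trigger f st).1.Settled f := by
  have hq : 0 < quorum n f := Nat.succ_pos _
  unfold trigger
  split <;> rename_i hp <;> try split_ifs with hc
  · refine ⟨⟨h.safety_signed, h.safety_mem, h.safety_inj, fun _ => hc, h.acks, h.acks_inj, ?_,
      h.byz, fun _ => h.early (by simp [hp, Phase.rank]), h.safe, ?_, ?_⟩, ?_, ?_, ?_⟩
    · simp [Phase.rank]
    · simp [Phase.rank]
    · simpa [hp, Phase.rank] using h.decision
    · simp [Phase.rank]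
    · intro; simpa [h.acks_init (by simp [hp, Phase.rank])] using hq
    · simp [Phase.rank]
  · refine ⟨h, ?_, ?_, ?_⟩ <;> simp [hp, Phase.rank]
    omega
  · have hr : st.phase.rank = 1 := by simp [hp, Phase.rank]
    obtain ⟨he, ht⟩ := h.early hr.le
    refine ⟨⟨h.safety_signed, h.safety_mem, h.safety_inj, fun _ => h.safety_card hr.ge, h.acks,
      h.acks_inj, ?_, h.byz, ?_, h.safe.union ?_, fun _ => ?_, ?_⟩, ?_, ?_, ?_⟩
    · simp [Phase.rank]
    · simp [Phase.rank]
    · intro e he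
      obtain ⟨v, hv, rfl⟩ := Finset.mem_image.1 he
      rw [Finset.mem_filter] at hv
      exact ⟨hc, fun a ha => (h.acks a ha).2.1 ▸ hv.1, hv.2, fun a ha => (h.acks a ha).1,
        h.acks_inj, h.safety_mem v hv.1⟩
    -- Here `ts` becomes `1`, and the potential bound reduces to `n ≤ card + 2f`.
    · have := h.first_proposal_card hσ hF hr.ge
      simp only [he, ht, Finset.empty_union, Proposal.values, Finset.image_image]
      rw [show (Prod.fst ∘ fun v => (v, st.safeAcks)) = id from rfl, Finset.image_id]
      omega
    · simpa [hp, Phase.rank] using h.decision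
    · simp [Phase.rank]
    · simp [Phase.rank]
    · intro; simpa using hq
  · refine ⟨h, ?_, ?_, ?_⟩ <;> simp [hp, Phase.rank]
    omega
  · have hr : st.phase.rank = 2 := by simp [hp, Phase.rank]
    refine ⟨⟨h.safety_signed, h.safety_mem, h.safety_inj, fun _ => h.safety_card (by omega),
      h.acks, h.acks_inj, ?_, h.byz, ?_, h.safe, fun _ => h.growth hr.ge, ?_⟩, ?_, ?_, ?_⟩ <;>
    simp [Phase.rank]
  · refine ⟨h, ?_, ?_, ?_⟩ <;> simp [hp, Phase.rank]
    omega
  · refine ⟨h, ?_, ?_, ?_⟩ <;> simp [hp, Phase.rank]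

/-- What is known about a message from a correct process `src` that answers the proposer with
the state `st`. -/
def IsAnswer (f : ℕ) (E : Set V) (pro : Fin n → V) (σ : Signatures n V)
    (st : ProposerState n V) (src : Fin n) : Msg n V → Prop
  | .initPhase x => x = ⟨pro src, src⟩
  | .safeAck a => a.signer = src ∧ a ∈ σ.acks ∧ 1 ≤ st.phase.rank ∧ a.rcvd = st.safetySet ∧
      ∀ c ∈ a.conflicts, VerifyConfPair σ c
  | .ack S x => 1 ≤ x ∧ x ≤ st.ts ∧ (x = st.ts → S = st.proposedSet)
  | .nack S x => 1 ≤ x ∧ x ≤ st.ts ∧ (x = st.ts → ¬ S.values ⊆ st.proposedSet.values) ∧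
      AllSafe f E σ S
  | _ => True

/-- What is known about a message sent by a correct proposer that is now in the state `st`. -/
def IsRequest (f : ℕ) (E : Set V) (σ : Signatures n V) (st : ProposerState n V) :
    Msg n V → Prop
  | .safeReq S => 1 ≤ st.phase.rank ∧ S = st.safetySet
  | .ackReq S x => 1 ≤ x ∧ x ≤ st.ts ∧ (x = st.ts → S = st.proposedSet) ∧ AllSafe f E σ S
  | _ => True

/-- Either the timestamp has grown and the clause about `x = ts` is vacuous, or the proposal is
unchanged. The safety set is frozen once `init` is left. -/
theorem IsAnswer.mono {σ τ : Signatures n V} {st st' : ProposerState n V} {src : Fin n}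
    {m : Msg n V} (h : IsAnswer f E pro σ st src m) (hle : σ.Le τ) (ha : st.Advance F st') :
    IsAnswer f E pro τ st' src m := by
  cases m with
  | safeAck a =>
    obtain ⟨h1, h2, h3, h4, h5⟩ := h
    exact ⟨h1, hle.acks h2, h3.trans ha.rank, h4.trans (ha.safetySet_eq h3).symm,
      fun c hc => (h5 c hc).mono hle⟩
  | ack S x =>
    obtain ⟨h1, h2, h3⟩ := h
    refine ⟨h1, h2.trans ha.ts_le, fun hx => ?_⟩
    rcases ha.ts with h | ⟨h, h', -⟩
    · omega
    · exact (h3 (by omega)).trans h'.symm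
  | nack S x =>
    obtain ⟨h1, h2, h3, h4⟩ := h
    refine ⟨h1, h2.trans ha.ts_le, fun hx => ?_, h4.mono hle⟩
    rcases ha.ts with h | ⟨h, h', -⟩
    · omega
    · exact h' ▸ h3 (by omega)
  | _ => exact h

theorem IsRequest.mono {σ τ : Signatures n V} {st st' : ProposerState n V} {m : Msg n V}
    (h : IsRequest f E σ st m) (hle : σ.Le τ) (ha : st.Advance F st') :
    IsRequest f E τ st' m := by
  cases m with
  | safeReq S => exact ⟨h.1.trans ha.rank, h.2.trans (ha.safetySet_eq h.1).symm⟩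
  | ackReq S x =>
    obtain ⟨h1, h2, h3, h4⟩ := h
    refine ⟨h1, h2.trans ha.ts_le, fun hx => ?_, h4.mono hle⟩
    rcases ha.ts with h | ⟨h, h', -⟩
    · omega
    · exact (h3 (by omega)).trans h'.symm
  | _ => exact h

/-- A branch that extends `byz` runs only after a failed test; `IsAnswer` makes every such test
succeed for a correct sender, so `byz` stays inside `F`. -/
theorem proposerHandle_inv {σ : Signatures n V} {st : ProposerState n V}
    (h : ProposerInv f E F σ st) {src : Fin n} {m : Msg n V}
    (hm : src ∉ F → IsAnswer f E pro σ st src m) :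
    ProposerInv f E F σ (proposerHandle f E σ st src m).1 := by
  have hbyz : src ∈ F → insert src st.byz ⊆ F := fun hs => Finset.insert_subset hs h.byz
  unfold proposerHandle
  split <;> rename_i hp <;> try split_ifs with h1 h2
  · rename_i x
    have hI : ∀ y ∈ insert x st.safetySet, y ∈ σ.vals := by
      intro y hy
      rcases Finset.mem_insert.1 hy with rfl | hy
      exacts [h1.2.1, h.safety_signed y hy]
    have hr : st.phase.rank = 0 := by simp [hp, Phase.rank]
    exact { h with
      safety_signed := fun y hy => hI y (mem_removeConflicts.1 hy).1
      safety_mem := fun y hy => by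
        rcases Finset.mem_insert.1 (mem_removeConflicts.1 hy).1 with rfl | hy
        exacts [h1.2.2, h.safety_mem y hy]
      safety_inj := fun y hy z hz => removeConflicts_value_eq hI hy hz
      safety_card := fun hr' => absurd hr' (by simp [hr])
      -- The safety set may change here, and `rcvd = safetySet` survives because no acknowledgement
      -- has been collected yet.
      acks := by simp [h.acks_init hr] }
  · exact h
  · exact h
  · exact { h with
      acks := fun a ha => by
        rcases Finset.mem_insert.1 ha with rfl | ha
        exacts [h1.2, h.acks a ha]
      acks_inj := fun a ha b hb hab => by
        rcases Finset.mem_insert.1 ha with ha | ha <;> rcases Finset.mem_insert.1 hb with hb | hb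
        · exact absurd (ha.trans hb.symm) hab
        · exact fun he => h2 ⟨b, hb, by rw [← he, ha, h1.1]⟩
        · exact fun he => h2 ⟨a, ha, by rw [he, hb, h1.1]⟩
        · exact h.acks_inj a ha b hb hab
      acks_init := fun hr => absurd hr (by simp [hp, Phase.rank]) }
  · refine { h with byz := hbyz (by_contra fun hs => h1 ?_) }
    obtain ⟨a1, a2, -, a3, a4⟩ := hm hs
    exact ⟨a1, a2, a3, a4⟩
  · exact { h with }
  · refine { h with byz := hbyz (by_contra fun hs => h2 ?_) }
    obtain ⟨-, -, a⟩ := hm hs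
    exact ⟨by rw [a h1], fun hb => hs (h.byz hb)⟩
  · exact h
  · rename_i S _
    have hr : st.phase.rank = 2 := by simp [hp, Phase.rank]
    refine { h with
      early := fun hr' => absurd hr' (by simp [hr])
      safe := h2.2.2.union h.safe
      growth := fun _ => ⟨Nat.succ_pos _, ?_⟩ }
    have := h.growth hr.ge
    -- The test on the nack forces a strict increase, which pays for the increment of `ts`.
    have hlt : st.proposedSet.values.card < (Proposal.values (S ∪ st.proposedSet)).card :=
      Finset.card_lt_card (Finset.ssubset_iff_subset_ne.2
        ⟨by rw [Proposal.values_union]; exact Finset.subset_union_right,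
          by rw [Proposal.values_union]; exact h2.1⟩)
    simp only
    omega
  · refine { h with byz := hbyz (by_contra fun hs => h2 ?_) }
    obtain ⟨-, -, a, a'⟩ := hm hs
    exact ⟨fun he => a h1 (he ▸ Finset.subset_union_left), fun hb => hs (h.byz hb), a'⟩
  · exact h
  · exact h

theorem proposerReceive_inv {σ : Signatures n V} (hσ : σ.Genuine F pro) (hF : F.card ≤ f)
    {st : ProposerState n V} (h : ProposerInv f E F σ st) {src : Fin n} {m : Msg n V}
    (hm : src ∉ F → IsAnswer f E pro σ st src m) :
    ProposerInv f E F σ (proposerReceive f E σ st src m).1 ∧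
      (proposerReceive f E σ st src m).1.Settled f :=
  trigger_inv hσ hF (proposerHandle_inv h hm)

theorem trigger_decision {st : ProposerState n V} (h : st.phase.rank = 0) :
    (trigger f st).1.decision = st.decision := by
  unfold trigger
  split <;> (try split_ifs) <;> simp_all [Phase.rank]

/-! ### Messages of the proposer -/

theorem mem_trigger {st : ProposerState n V} {m : Msg n V} (h : m ∈ (trigger f st).2) :
    (m = .safeReq (trigger f st).1.safetySet ∧ (trigger f st).1.phase.rank = 1) ∨
      (m = .ackReq (trigger f st).1.proposedSet (trigger f st).1.ts ∧
        (trigger f st).1.phase.rank = 2) := by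
  unfold trigger at h ⊢
  split at h <;> (try split_ifs at h with hc) <;> simp_all [Phase.rank]

theorem trigger_messages (st : ProposerState n V) :
    ((trigger f st).1.phase.rank = st.phase.rank ∧ (trigger f st).1.ts = st.ts ∧
        (trigger f st).1.proposedSet = st.proposedSet) ∨
      (st.phase.rank = 0 ∧ (trigger f st).1.phase.rank = 1 ∧
        .safeReq (trigger f st).1.safetySet ∈ (trigger f st).2) ∨
      (st.phase.rank = 1 ∧ (trigger f st).1.phase.rank = 2 ∧
        .ackReq (trigger f st).1.proposedSet (trigger f st).1.ts ∈ (trigger f st).2) ∨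
      (st.phase.rank = 2 ∧ (trigger f st).1.phase.rank = 3 ∧ (trigger f st).1.ts = st.ts ∧
        (trigger f st).1.proposedSet = st.proposedSet) := by
  unfold trigger
  split <;> (try split_ifs with hc) <;> simp_all [Phase.rank]

theorem proposerHandle_phase (σ : Signatures n V) (st : ProposerState n V) (src : Fin n)
    (m : Msg n V) : (proposerHandle f E σ st src m).1.phase = st.phase := by
  unfold proposerHandle
  split <;> (try split_ifs) <;> rfl

theorem proposerHandle_messages (σ : Signatures n V) (st : ProposerState n V) (src : Fin n)
    (m : Msg n V) :
    ((proposerHandle f E σ st src m).2 = [] ∧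
        (proposerHandle f E σ st src m).1.ts = st.ts ∧
        (proposerHandle f E σ st src m).1.proposedSet = st.proposedSet) ∨
      ((proposerHandle f E σ st src m).2 =
          [.ackReq (proposerHandle f E σ st src m).1.proposedSet
            (proposerHandle f E σ st src m).1.ts] ∧ st.phase.rank = 2) := by
  unfold proposerHandle
  split <;> (try split_ifs) <;> simp_all [Phase.rank]

theorem mem_proposerReceive {σ : Signatures n V} {st : ProposerState n V} {src : Fin n}
    {m m' : Msg n V} (h : m' ∈ (proposerReceive f E σ st src m).2) :
    (m' = .safeReq (proposerReceive f E σ st src m).1.safetySet ∧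
        1 ≤ (proposerReceive f E σ st src m).1.phase.rank) ∨
      (m' = .ackReq (proposerReceive f E σ st src m).1.proposedSet
          (proposerReceive f E σ st src m).1.ts ∧
        2 ≤ (proposerReceive f E σ st src m).1.phase.rank) := by
  have hp := proposerHandle_phase (f := f) (E := E) σ st src m
  simp only [proposerReceive, List.mem_append] at h ⊢
  rcases h with h | h
  · rcases proposerHandle_messages (f := f) (E := E) σ st src m with ⟨h0, -⟩ | ⟨h0, hr⟩
    · simp [h0] at h
    · rw [h0, List.mem_singleton] at h
      rw [← hp] at hr
      -- The handler's request describes the intermediate state; in phase `proposing` the trigger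
      -- changes neither the proposal nor the timestamp, so it also describes the final one.
      rcases trigger_messages (f := f) (proposerHandle f E σ st src m).1 with h' | h' | h' | h'
      · exact .inr ⟨by rw [h, h'.2.1, h'.2.2], by omega⟩
      · omega
      · omega
      · exact .inr ⟨by rw [h, h'.2.2.1, h'.2.2.2], by omega⟩
  · exact (mem_trigger h).imp (fun h => ⟨h.1, h.2.ge⟩) fun h => ⟨h.1, h.2.ge⟩

theorem safeReq_mem_proposerReceive {σ : Signatures n V} {st : ProposerState n V} {src : Fin n}
    {m : Msg n V} (h0 : st.phase.rank = 0)
    (h1 : 1 ≤ (proposerReceive f E σ st src m).1.phase.rank) :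
    .safeReq (proposerReceive f E σ st src m).1.safetySet ∈
      (proposerReceive f E σ st src m).2 := by
  rw [← proposerHandle_phase (f := f) (E := E) σ st src m] at h0
  simp only [proposerReceive, List.mem_append] at h1 ⊢
  rcases trigger_messages (f := f) (proposerHandle f E σ st src m).1 with h' | h' | h' | h' <;>
    first | omega | exact .inr h'.2.2

theorem ackReq_mem_proposerReceive (σ : Signatures n V) (st : ProposerState n V) (src : Fin n)
    (m : Msg n V) (h2 : (proposerReceive f E σ st src m).1.phase.rank = 2) :
    (st.phase.rank = 2 ∧ (proposerReceive f E σ st src m).1.ts = st.ts ∧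
        (proposerReceive f E σ st src m).1.proposedSet = st.proposedSet) ∨
      .ackReq (proposerReceive f E σ st src m).1.proposedSet
        (proposerReceive f E σ st src m).1.ts ∈ (proposerReceive f E σ st src m).2 := by
  have hp := proposerHandle_phase (f := f) (E := E) σ st src m
  simp only [proposerReceive, List.mem_append] at h2 ⊢
  rcases trigger_messages (f := f) (proposerHandle f E σ st src m).1 with h' | h' | h' | h'
  · rw [h'.2.1, h'.2.2]
    rcases proposerHandle_messages (f := f) (E := E) σ st src m with ⟨-, h3, h4⟩ | ⟨h0, hr⟩
    · exact .inl ⟨by rw [← hp, ← h'.1, h2], h3, h4⟩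
    · exact .inr (.inl (by simp [h0]))
  · omega
  · exact .inr (.inr h'.2.2)
  · omega

/-! ### Reactions of the proposer to the answers of correct processes -/

theorem Phase.rank_eq_zero {x : Phase} : x.rank = 0 ↔ x = .init := by
  cases x <;> simp [Phase.rank]

theorem Phase.rank_eq_one {x : Phase} : x.rank = 1 ↔ x = .safetying := by
  cases x <;> simp [Phase.rank]

theorem Phase.rank_eq_two {x : Phase} : x.rank = 2 ↔ x = .proposing := by
  cases x <;> simp [Phase.rank]

theorem Phase.rank_le (x : Phase) : x.rank ≤ 3 := by
  cases x <;> simp [Phase.rank]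

theorem proposerReceive_initPhase {σ : Signatures n V} (hσ : σ.Genuine F pro)
    {st : ProposerState n V} {s : Fin n} (hs : s ∉ F) (hE : pro s ∈ E)
    (hr : (proposerReceive f E σ st s (.initPhase ⟨pro s, s⟩)).1.phase.rank = 0) :
    (⟨pro s, s⟩ : SignedValue n V) ∈
      (proposerReceive f E σ st s (.initPhase ⟨pro s, s⟩)).1.safetySet := by
  have ha := proposerReceive_advance (f := f) (E := E) hσ st s (.initPhase ⟨pro s, s⟩)
  have hp : st.phase = .init := Phase.rank_eq_zero.1 (by have := ha.rank; omega)
  refine (trigger_advance (F := F) _).safetySet_correct hr _ ?_ hs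
  simp only [proposerHandle, hp, hσ.input_mem s hs, hE, and_self, if_true]
  exact mem_removeConflicts_of_correct hσ (Finset.mem_insert_self _ _) hs

/-- The message `a` itself is dropped if another one of `s` was kept before; only the signer matters
for the count. -/
theorem proposerReceive_safeAck {σ : Signatures n V} {st : ProposerState n V} {a : SafeAck n V}
    {s : Fin n} (hr : st.phase.rank = 1) (ha : IsAnswer f E pro σ st s (.safeAck a)) :
    ∃ b ∈ (proposerReceive f E σ st s (.safeAck a)).1.safeAcks, b.signer = s := by
  obtain ⟨h1, h2, -, h3, h4⟩ := ha
  suffices h : ∃ b ∈ (proposerHandle f E σ st s (.safeAck a)).1.safeAcks, b.signer = s by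
    obtain ⟨b, hb, hbs⟩ := h
    exact ⟨b, (trigger_advance (F := ∅) _).safeAcks hb, hbs⟩
  simp only [proposerHandle, Phase.rank_eq_one.1 hr]
  rw [if_pos ⟨h1, h2, h3, h4⟩]
  split_ifs with h
  · exact h
  · exact ⟨a, Finset.mem_insert_self _ _, h1⟩

theorem proposerReceive_ack {σ : Signatures n V} {st : ProposerState n V} {S : Proposal n V}
    {s : Fin n} (hr : st.phase.rank = 2) (hs : s ∉ st.byz)
    (ha : IsAnswer f E pro σ st s (.ack S st.ts)) :
    s ∈ (proposerReceive f E σ st s (.ack S st.ts)).1.ackSet := by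
  obtain ⟨-, -, h⟩ := ha
  have hp := Phase.rank_eq_two.1 hr
  have hh : proposerHandle f E σ st s (.ack S st.ts) =
      ({ st with ackSet := insert s st.ackSet }, []) := by
    simp [proposerHandle, hp, h rfl, hs]
  simp only [proposerReceive, hh, trigger, hp]
  split_ifs <;> exact Finset.mem_insert_self _ _

theorem proposerReceive_nack {σ : Signatures n V} {st : ProposerState n V} {S : Proposal n V}
    {s : Fin n} (hr : st.phase.rank = 2) (hs : s ∉ st.byz)
    (ha : IsAnswer f E pro σ st s (.nack S st.ts)) :
    st.ts < (proposerReceive f E σ st s (.nack S st.ts)).1.ts := by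
  obtain ⟨-, -, h, hS⟩ := ha
  refine lt_of_lt_of_le ?_ (trigger_advance (F := ∅) _).ts_le
  simp only [proposerHandle, Phase.rank_eq_two.1 hr, if_true]
  rw [if_pos ⟨fun he => h rfl (he ▸ Finset.subset_union_left), hs, hS⟩]
  exact Nat.lt_succ_self _

/-! ### Global steps -/

theorem next_sigs_le (c : Config n V) (ev : Event n V) : c.sigs.Le (next f E F c ev).sigs := by
  cases ev with
  | deliver e =>
    simp only [next]
    split_ifs
    exacts [.refl _, ⟨subset_rfl, Set.subset_union_left⟩]
  | signValue x => exact ⟨Set.subset_insert _ _, subset_rfl⟩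
  | signAck a => exact ⟨subset_rfl, Set.subset_insert _ _⟩
  | idle => exact .refl _

theorem next_genuine {c : Config n V} (hc : c.sigs.Genuine F pro) {ev : Event n V}
    (hev : ∀ x, ev = .signValue x → x.sender ∈ F) : (next f E F c ev).sigs.Genuine F pro := by
  cases ev with
  | deliver e =>
    simp only [next]
    split_ifs
    exacts [hc, ⟨hc.value_eq, hc.input_mem⟩]
  | signValue x =>
    refine ⟨?_, fun s hs => Set.mem_insert_of_mem _ (hc.input_mem s hs)⟩
    rintro y (rfl | hy) hF
    exacts [absurd (hev _ rfl) hF, hc.value_eq y hy hF]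
  | signAck a => exact ⟨hc.value_eq, hc.input_mem⟩
  | idle => exact hc

theorem next_proposer_of_ne {c : Config n V} {ev : Event n V} {p : Fin n}
    (h : ∀ e, ev = .deliver e → e.dst ≠ p) : (next f E F c ev).proposer p = c.proposer p := by
  cases ev with
  | deliver e =>
    simp only [next]
    split_ifs
    exacts [rfl, Function.update_of_ne (h e rfl).symm _ _]
  | _ => rfl

theorem next_proposer {c : Config n V} {e : Envelope n V} (h : e.dst ∉ F) :
    (next f E F c (.deliver e)).proposer e.dst =
      (proposerReceive f E c.sigs (c.proposer e.dst) e.src e.msg).1 := by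
  simp [next, h]

theorem next_advance {c : Config n V} (hc : c.sigs.Genuine F pro) (ev : Event n V) {p : Fin n}
    (hp : p ∉ F) : (c.proposer p).Advance F ((next f E F c ev).proposer p) := by
  by_cases h : ∃ e, ev = .deliver e ∧ e.dst = p
  · obtain ⟨e, rfl, rfl⟩ := h
    rw [next_proposer hp]
    exact proposerReceive_advance hc _ _ _
  · push Not at h
    rw [next_proposer_of_ne h]
    exact .refl _

theorem next_acceptor_inv {c : Config n V} {s : Fin n} (hs : s ∉ F)
    (h : AcceptorInv f E c.sigs s (c.acceptor s)) {ev : Event n V}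
    (hev : ∀ a, ev = .signAck a → a.signer ∈ F) :
    AcceptorInv f E (next f E F c ev).sigs s ((next f E F c ev).acceptor s) := by
  cases ev with
  | deliver e =>
    simp only [next]
    split_ifs with he
    · exact h
    · by_cases hse : s = e.dst
      · subst hse
        simpa using acceptorReceive_inv h e.msg
      · simp only [Function.update_of_ne hse]
        refine h.mono ⟨subset_rfl, Set.subset_union_left⟩ ?_
        rintro a (ha | ha) has
        exacts [ha, absurd (has.symm.trans (acceptorReceive_signer ha)) hse]
  | signValue x => exact h.mono ⟨Set.subset_insert _ _, subset_rfl⟩ fun a ha _ => ha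
  | signAck a =>
    refine h.mono ⟨subset_rfl, Set.subset_insert _ _⟩ ?_
    rintro b (rfl | hb) hbs
    exacts [absurd (hev _ rfl) (hbs ▸ hs), hb]
  | idle => exact h

theorem isRequest_of_inv {σ : Signatures n V} {st : ProposerState n V}
    (h : ProposerInv f E F σ st) {m : Msg n V}
    (hm : (m = .safeReq st.safetySet ∧ 1 ≤ st.phase.rank) ∨
      (m = .ackReq st.proposedSet st.ts ∧ 2 ≤ st.phase.rank)) :
    (∀ τ st' src, IsAnswer f E pro τ st' src m) ∧ IsRequest f E σ st m := by
  rcases hm with ⟨rfl, hr⟩ | ⟨rfl, hr⟩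
  · exact ⟨fun _ _ _ => trivial, hr, rfl⟩
  · exact ⟨fun _ _ _ => trivial, (h.growth hr).1, le_rfl, fun _ => rfl, h.safe⟩

/-! ### The inductive invariant of executions -/

namespace Execution

/-- The message `e` was sent by a correct process before the `k`-th event. -/
def Sent (X : Execution f E F pro) (k : ℕ) (e : Envelope n V) : Prop :=
  e ∈ initialMsgs f F pro ∨ ∃ j < k, e ∈ emitted f E F (X.config j) (X.event j)

/-- The invariant of executions. -/
structure Inv (X : Execution f E F pro) (k : ℕ) : Prop where
  genuine : (X.config k).sigs.Genuine F pro
  acceptor : ∀ s, s ∉ F → AcceptorInv f E (X.config k).sigs s ((X.config k).acceptor s)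
  proposer : ∀ p, p ∉ F → ProposerInv f E F (X.config k).sigs ((X.config k).proposer p)
  settled : ∀ p, p ∉ F → ((X.config k).proposer p).Settled f
  sent : ∀ e, X.Sent k e → e.src ∉ F → e.dst ∉ F →
    IsAnswer f E pro (X.config k).sigs ((X.config k).proposer e.dst) e.src e.msg ∧
      IsRequest f E (X.config k).sigs ((X.config k).proposer e.src) e.msg
  safeReq : ∀ p, p ∉ F → ∀ q, 1 ≤ ((X.config k).proposer p).phase.rank →
    X.Sent k ⟨p, q, .safeReq ((X.config k).proposer p).safetySet⟩
  ackReq : ∀ p, p ∉ F → ∀ q, ((X.config k).proposer p).phase.rank = 2 →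
    X.Sent k ⟨p, q, .ackReq ((X.config k).proposer p).proposedSet ((X.config k).proposer p).ts⟩

theorem Sent.mono {X : Execution f E F pro} {k l : ℕ} {e : Envelope n V} (h : X.Sent k e)
    (hkl : k ≤ l) : X.Sent l e :=
  h.imp_right fun ⟨j, hj, he⟩ => ⟨j, hj.trans_le hkl, he⟩

theorem inv_zero (X : Execution f E F pro) (hF : F.card ≤ f) (hpro : ∀ p, p ∉ F → pro p ∈ E) :
    X.Inv 0 := by
  have hg : (initialConfig f F pro).sigs.Genuine F pro :=
    ⟨fun x hx _ => hx.2, fun s hs => ⟨hs, rfl⟩⟩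
  have hP := fun p (hp : p ∉ F) => trigger_inv hg hF (proposerStart_inv hg hp (hpro p hp))
  have hr : ∀ p, (proposerStart p (pro p)).phase.rank = 0 := fun _ => rfl
  constructor <;> rw [X.config_zero]
  · exact hg
  · intro s _
    constructor <;> simp [initialConfig, allSafe_empty]
  · exact fun p hp => (hP p hp).1
  · exact fun p hp => (hP p hp).2
  · rintro e (⟨-, he⟩ | ⟨j, hj, -⟩) hs hd
    · rcases List.mem_cons.1 he with he | he
      · rw [he]
        exact ⟨rfl, trivial⟩
      · have := isRequest_of_inv (pro := pro) (hP _ hs).1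
          ((mem_trigger he).imp (fun h => ⟨h.1, h.2.ge⟩) fun h => ⟨h.1, h.2.ge⟩)
        exact ⟨this.1 _ _ _, this.2⟩
    · exact absurd hj (Nat.not_lt_zero _)
  · intro p hp q h1
    refine .inl ⟨hp, List.mem_cons_of_mem _ ?_⟩
    rcases trigger_messages (f := f) (proposerStart p (pro p)) with h | h | h | h
    · exact absurd h1 (by rw [initialConfig, h.1, hr]; simp)
    · exact h.2.2
    · exact absurd h.1 (by rw [hr]; simp)
    · exact absurd h.1 (by rw [hr]; simp)
  · intro p hp q h1
    rcases trigger_messages (f := f) (proposerStart p (pro p)) with h | h | h | h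
    · exact absurd h1 (by rw [initialConfig, h.1, hr]; simp)
    · exact absurd h1 (by rw [initialConfig, h.2.1]; simp)
    · exact absurd h.1 (by rw [hr]; simp)
    · exact absurd h.1 (by rw [hr]; simp)

/-- Authenticity turns a delivery from a correct process into an earlier sending, so `sent`
describes the delivered message. An acceptor's reply inherits its `IsAnswer` property from the
`IsRequest` property of the request, which is why both are carried together. -/
theorem Inv.succ {X : Execution f E F pro} (hF : F.card ≤ f) {k : ℕ} (h : X.Inv k) :
    X.Inv (k + 1) := by
  have hg : (X.config (k + 1)).sigs.Genuine F pro :=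
    X.config_succ k ▸ next_genuine h.genuine (X.signValue_byz k)
  have hle : (X.config k).sigs.Le (X.config (k + 1)).sigs := X.config_succ k ▸ next_sigs_le _ _
  have hadv : ∀ p, p ∉ F →
      ((X.config k).proposer p).Advance F ((X.config (k + 1)).proposer p) := fun p hp =>
    X.config_succ k ▸ next_advance h.genuine _ hp
  have hstep : ∀ p, (∃ e, X.event k = .deliver e ∧ e.dst = p) ∨
      (X.config (k + 1)).proposer p = (X.config k).proposer p := fun p => by
    by_cases he : ∃ e, X.event k = .deliver e ∧ e.dst = p
    · exact .inl he
    · push Not at he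
      exact .inr (X.config_succ k ▸ next_proposer_of_ne he)
  have hanswer : ∀ e, X.event k = .deliver e → e.dst ∉ F → e.src ∉ F →
      IsAnswer f E pro (X.config k).sigs ((X.config k).proposer e.dst) e.src e.msg ∧
        IsRequest f E (X.config k).sigs ((X.config k).proposer e.src) e.msg := fun e he hd hs =>
    h.sent e (X.authentic k e he hs) hs hd
  have hnext : ∀ e, X.event k = .deliver e → e.dst ∉ F → (X.config (k + 1)).proposer e.dst =
      (proposerReceive f E (X.config k).sigs ((X.config k).proposer e.dst) e.src e.msg).1 :=
    fun e he hd => by rw [X.config_succ, he, next_proposer hd]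
  have hprop : ∀ p, p ∉ F →
      ProposerInv f E F (X.config (k + 1)).sigs ((X.config (k + 1)).proposer p) ∧
        ((X.config (k + 1)).proposer p).Settled f := by
    intro p hp
    rcases hstep p with ⟨e, he, rfl⟩ | hst
    · rw [hnext e he hp]
      have := proposerReceive_inv h.genuine hF (h.proposer _ hp) fun hs => (hanswer e he hp hs).1
      exact ⟨this.1.mono hle, this.2⟩
    · rw [hst]
      exact ⟨(h.proposer p hp).mono hle, h.settled p hp⟩
  refine ⟨hg, fun s hs => ?_, fun p hp => (hprop p hp).1, fun p hp => (hprop p hp).2, ?_, ?_, ?_⟩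
  · exact X.config_succ k ▸ next_acceptor_inv hs (h.acceptor s hs) (X.signAck_byz k)
  · intro e' hsent hs' hd'
    by_cases hold : X.Sent k e'
    · have := h.sent e' hold hs' hd'
      exact ⟨this.1.mono hle (hadv _ hd'), this.2.mono hle (hadv _ hs')⟩
    have hem : e' ∈ emitted f E F (X.config k) (X.event k) := by
      rcases hsent with hi | ⟨j, hj, hj'⟩
      · exact absurd (.inl hi) hold
      · rcases (Nat.lt_succ_iff.1 hj).lt_or_eq with hlt | rfl
        · exact absurd (.inr ⟨j, hlt, hj'⟩) hold
        · exact hj'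
    rcases hev : X.event k with e | _ | _ | _ <;> rw [hev] at hem
    rotate_left
    · exact absurd hem (Set.notMem_empty _)
    · exact absurd hem (Set.notMem_empty _)
    · exact absurd hem (Set.notMem_empty _)
    obtain ⟨hd, hsd, hm | ⟨hds, hm⟩⟩ := hem
    · have hm' := mem_proposerReceive hm
      rw [← hnext e hev hd] at hm'
      have := isRequest_of_inv (pro := pro) (hprop _ hd).1 hm'
      rw [hsd]
      exact ⟨this.1 _ _ _, this.2⟩
    · have hreq := (hanswer e hev hd (hds ▸ hd')).2
      rw [hds, hsd]
      have hadv' := hadv _ (hds ▸ hd')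
      rcases mem_acceptorReceive hm with ⟨S, hS, hm'⟩ | ⟨S, x, hS, hm'⟩ | ⟨S, x, hS, hv, hm'⟩ <;>
        rw [hS] at hreq <;> rw [hm'] <;> refine ⟨?_, trivial⟩
      · have hreq' := hreq.mono hle hadv'
        refine ⟨rfl, ?_, hreq'.1, hreq'.2, fun c hc => (mem_returnConflicts.1 hc).2.mono hle⟩
        -- The acknowledgement is signed by the very event that sends it.
        rw [X.config_succ, hev]
        simp only [next, if_neg hd]
        rw [hm'] at hm
        exact .inr hm
      · obtain ⟨h1, h2, h3, -⟩ := hreq.mono hle hadv'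
        exact ⟨h1, h2, h3⟩
      · obtain ⟨h1, h2, h3, -⟩ := hreq.mono hle hadv'
        exact ⟨h1, h2, fun hx => h3 hx ▸ hv, (h.acceptor _ hd).accepted_safe.mono hle⟩
  · intro p hp q hr
    by_cases h0 : ((X.config k).proposer p).phase.rank = 0
    · rcases hstep p with ⟨e, he, rfl⟩ | hst
      · rw [hnext e he hp] at hr ⊢
        refine .inr ⟨k, k.lt_succ_self, ?_⟩
        rw [he]
        exact ⟨hp, rfl, .inl (safeReq_mem_proposerReceive h0 hr)⟩
      · rw [hst, h0] at hr
        omega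
    · have h1 := Nat.one_le_iff_ne_zero.2 h0
      rw [(hadv p hp).safetySet_eq h1]
      exact (h.safeReq p hp q h1).mono k.le_succ
  · intro p hp q hr
    rcases hstep p with ⟨e, he, rfl⟩ | hst
    · rw [hnext e he hp] at hr ⊢
      rcases ackReq_mem_proposerReceive _ _ _ _ hr with ⟨h1, h2, h3⟩ | hm
      · rw [h2, h3]
        exact (h.ackReq _ hp q h1).mono k.le_succ
      · refine .inr ⟨k, k.lt_succ_self, ?_⟩
        rw [he]
        exact ⟨hp, rfl, .inl hm⟩
    · rw [hst] at hr ⊢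
      exact (h.ackReq p hp q hr).mono k.le_succ

theorem inv (X : Execution f E F pro) (hF : F.card ≤ f) (hpro : ∀ p, p ∉ F → pro p ∈ E)
    (k : ℕ) : X.Inv k := by
  induction k with
  | zero => exact X.inv_zero hF hpro
  | succ k ih => exact ih.succ hF

theorem advance {X : Execution f E F pro} (hX : ∀ k, X.Inv k) {p : Fin n} (hp : p ∉ F)
    {k l : ℕ} (hkl : k ≤ l) :
    ((X.config k).proposer p).Advance F ((X.config l).proposer p) := by
  induction hkl with
  | refl => exact .refl _
  | step _ ih => exact ih.trans (X.config_succ _ ▸ next_advance (hX _).genuine _ hp)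

theorem proposer_succ (X : Execution f E F pro) {k : ℕ} {e : Envelope n V}
    (he : X.event k = .deliver e) (hd : e.dst ∉ F) : (X.config (k + 1)).proposer e.dst =
      (proposerReceive f E (X.config k).sigs ((X.config k).proposer e.dst) e.src e.msg).1 := by
  rw [X.config_succ, he, next_proposer hd]

/-! ### Termination -/

/-- `B r j` expresses that the `j`-th event takes place within `r` message delays. -/
structure Deadline (X : Execution f E F pro) (B : ℕ → ℕ → Prop) : Prop where
  init : ∀ e ∈ initialMsgs f F pro, e.dst ∉ F → ∃ j, X.event j = .deliver e ∧ B 1 j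
  emitted : ∀ r k, B r k → ∀ e ∈ emitted f E F (X.config k) (X.event k), e.dst ∉ F →
    ∃ j, X.event j = .deliver e ∧ B (r + 1) j
  mono : ∀ r r' j, r ≤ r' → B r j → B r' j
  anti : ∀ r j j', j' ≤ j → B r j → B r j'

variable {X : Execution f E F pro} {B : ℕ → ℕ → Prop}

/-- The index `j + 1` includes messages emitted by event `j` itself; anything sent earlier meets the
same deadline by `anti`, and initial messages by `mono`. -/
theorem Deadline.deliver (hB : X.Deadline B) {r j : ℕ} (hj : B r j) {e : Envelope n V}
    (he : X.Sent (j + 1) e) (hd : e.dst ∉ F) : ∃ i, X.event i = .deliver e ∧ B (r + 1) i := by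
  rcases he with he | ⟨i, hi, he⟩
  · obtain ⟨i, hi, hb⟩ := hB.init e he hd
    exact ⟨i, hi, hB.mono _ _ _ (Nat.le_add_left 1 r) hb⟩
  · exact hB.emitted r i (hB.anti _ _ _ (Nat.lt_succ_iff.1 hi) hj) e he hd

/-- The reply of a correct acceptor is delivered one message delay after the request. -/
theorem Deadline.reply (hB : X.Deadline B) {p s : Fin n} (hp : p ∉ F) (hs : s ∉ F) {r j : ℕ}
    (hj : B r j) {m m' : Msg n V} (he : X.event j = .deliver ⟨p, s, m⟩)
    (hm : m' ∈ (acceptorReceive f E (X.config j).sigs s ((X.config j).acceptor s) m).2) :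
    ∃ i, X.event i = .deliver ⟨s, p, m'⟩ ∧ B (r + 1) i :=
  hB.emitted r j hj _ (by rw [he]; exact ⟨hs, rfl, .inr ⟨rfl, hm⟩⟩) hp

/-- There are finitely many correct processes, so the latest of their events serves for all; `p`
only makes the set nonempty. -/
theorem Deadline.exists_last {p : Fin n} (hp : p ∉ F) {r : ℕ}
    {Q : Fin n → ℕ → Prop} (h : ∀ s, s ∉ F → ∃ j, Q s j ∧ B r j) :
    ∃ k, B r k ∧ ∀ s, s ∉ F → ∃ j ≤ k, Q s j := by
  choose! g hg using h
  obtain ⟨q, hq, hmax⟩ := Finset.exists_max_image (Finset.univ \ F) g ⟨p, by simp [hp]⟩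
  simp only [Finset.mem_sdiff, Finset.mem_univ, true_and] at hq hmax
  exact ⟨g q, (hg q hq).2, fun s hs => ⟨g s, hmax s hs, (hg s hs).1⟩⟩

/-- After one message delay a correct proposer has left the phase `init`. -/
theorem Deadline.exists_safetying (hB : X.Deadline B) (hX : ∀ k, X.Inv k) (hF : F.card ≤ f)
    (hpro : ∀ p, p ∉ F → pro p ∈ E) {p : Fin n} (hp : p ∉ F) :
    ∃ k, B 1 k ∧ 1 ≤ ((X.config (k + 1)).proposer p).phase.rank := by
  obtain ⟨k, hk, hall⟩ := exists_last (B := B) (r := 1) hp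
    (Q := fun s j => X.event j = .deliver ⟨s, p, .initPhase ⟨pro s, s⟩⟩) fun s hs =>
      hB.init ⟨s, p, .initPhase ⟨pro s, s⟩⟩ ⟨hs, List.mem_cons_self⟩ hp
  refine ⟨k, hk, Nat.one_le_iff_ne_zero.2 fun h0 => ?_⟩
  have hlt := ((hX (k + 1)).settled p hp).init h0
  -- Correct inputs are never removed during `init`, so all have accumulated, enough to have fired
  -- the trigger.
  have hsub : (Finset.univ \ F).image (fun s => (⟨pro s, s⟩ : SignedValue n V)) ⊆
      ((X.config (k + 1)).proposer p).safetySet := by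
    intro x hx
    obtain ⟨s, hs, rfl⟩ := Finset.mem_image.1 hx
    replace hs : s ∉ F := by simpa using hs
    obtain ⟨j, hj, he⟩ := hall s hs
    have ha := advance hX hp (Nat.add_le_add_right hj 1)
    refine ha.safetySet_correct h0 _ ?_ hs
    have hr := ha.rank
    rw [X.proposer_succ he hp] at hr ⊢
    exact proposerReceive_initPhase (hX j).genuine hs (hpro s hs) (by simp only at hr ⊢; omega)
  have hc := Finset.card_le_card hsub
  rw [Finset.card_image_of_injective _ fun a b h => congrArg SignedValue.sender h,
    card_correct] at hc
  omega

/-- Two message delays later a correct proposer has left the phase `safetying`. -/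
theorem Deadline.exists_proposing (hB : X.Deadline B) (hX : ∀ k, X.Inv k) (hn : 3 * f + 1 ≤ n)
    (hF : F.card ≤ f) {p : Fin n} (hp : p ∉ F) {r k₀ : ℕ} (hk₀ : B r k₀)
    (h₀ : 1 ≤ ((X.config (k₀ + 1)).proposer p).phase.rank) :
    ∃ k, B (r + 2) k ∧ 2 ≤ ((X.config (k + 1)).proposer p).phase.rank := by
  set S := ((X.config (k₀ + 1)).proposer p).safetySet with hS
  obtain ⟨k, hk, hall⟩ := exists_last (B := B) (r := r + 2) hp
    (Q := fun s j => ∃ C, X.event j = .deliver ⟨s, p, .safeAck ⟨s, S, C⟩⟩) fun s hs => by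
      obtain ⟨j, he, hj⟩ := hB.deliver hk₀ ((hX (k₀ + 1)).safeReq p hp s h₀) hs
      have hreq := ((hX j).sent _ (X.authentic j _ he hp) hp hs).2
      obtain ⟨C, hC⟩ := acceptorReceive_safeReq (f := f) (E := E) s ((X.config j).acceptor s)
        (S := S) fun x hx => ((hX j).proposer p hp).safety_signed x (hreq.2 ▸ hx)
      obtain ⟨i, hi, hb⟩ := hB.reply hp hs hj he hC
      exact ⟨i, ⟨C, hi⟩, hb⟩
  refine ⟨k, hk, by_contra fun h2 => ?_⟩
  have hex : ∀ s, s ∉ F → ∃ b ∈ ((X.config (k + 1)).proposer p).safeAcks, b.signer = s := by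
    intro s hs
    obtain ⟨j, hj, C, he⟩ := hall s hs
    have hans := ((hX j).sent _ (X.authentic j _ he hs) hs hp).1
    have hr := (advance hX hp (hj.trans (k.le_add_right 1))).rank
    have hr' := hans.2.2.1
    simp only at hr'
    obtain ⟨b, hb, hbs⟩ := proposerReceive_safeAck (by simp only; omega) hans
    rw [← X.proposer_succ he hp] at hb
    exact ⟨b, (advance hX hp (Nat.add_le_add_right hj 1)).safeAcks hb, hbs⟩
  -- The reply of `p` to itself certifies that `init` has been left.
  have hr1 : ((X.config (k + 1)).proposer p).phase.rank = 1 := by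
    obtain ⟨j, hj, C, he⟩ := hall p hp
    have hr' := ((hX j).sent _ (X.authentic j _ he hp) hp hp).1.2.2.1
    have hr := (advance hX hp (hj.trans (k.le_add_right 1))).rank
    simp only at hr'
    omega
  have hlt := ((hX (k + 1)).settled p hp).safetying hr1
  have hsub : Finset.univ \ F ⊆
      ((X.config (k + 1)).proposer p).safeAcks.image SafeAck.signer := fun s hs =>
    Finset.mem_image.2 (hex s (by simpa using hs))
  have hc := (Finset.card_le_card hsub).trans Finset.card_image_le
  rw [card_correct] at hc
  have := quorum_le hn hF
  omega

/-- A proposal is refined or decided within two message delays. -/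
theorem Deadline.exists_refined (hB : X.Deadline B) (hX : ∀ k, X.Inv k) (hn : 3 * f + 1 ≤ n)
    (hF : F.card ≤ f) {p : Fin n} (hp : p ∉ F) {r k₀ : ℕ} (hk₀ : B r k₀)
    (h₀ : ((X.config (k₀ + 1)).proposer p).phase.rank = 2) :
    ∃ k, B (r + 2) k ∧ (((X.config (k + 1)).proposer p).phase.rank = 3 ∨
      2 ≤ ((X.config (k + 1)).proposer p).phase.rank ∧
        ((X.config (k₀ + 1)).proposer p).ts < ((X.config (k + 1)).proposer p).ts) := by
  set t := ((X.config (k₀ + 1)).proposer p).ts with ht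
  obtain ⟨k, hk, hall⟩ := exists_last (B := B) (r := r + 2) hp
    (Q := fun s j => ∃ S, X.event j = .deliver ⟨s, p, .ack S t⟩ ∨
      X.event j = .deliver ⟨s, p, .nack S t⟩) fun s hs => by
      obtain ⟨j, he, hj⟩ := hB.deliver hk₀ ((hX (k₀ + 1)).ackReq p hp s h₀) hs
      have hreq := ((hX j).sent _ (X.authentic j _ he hp) hp hs).2
      rcases acceptorReceive_ackReq s ((X.config j).acceptor s) t hreq.2.2.2 with hm | ⟨S, hm⟩
      · obtain ⟨i, hi, hb⟩ := hB.reply hp hs hj he hm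
        exact ⟨i, ⟨_, .inl hi⟩, hb⟩
      · obtain ⟨i, hi, hb⟩ := hB.reply hp hs hj he hm
        exact ⟨i, ⟨_, .inr hi⟩, hb⟩
  -- A positive timestamp is evidence that `safetying` is over.
  have hpos : ∀ {j}, 1 ≤ ((X.config j).proposer p).ts →
      2 ≤ ((X.config j).proposer p).phase.rank := fun {j} h1 => by
    by_contra hr
    have := (((hX j).proposer p hp).early (by omega)).2
    omega
  have htj : ∀ s, s ∉ F → ∃ j ≤ k, 1 ≤ t ∧ t ≤ ((X.config j).proposer p).ts ∧
      ∃ S, X.event j = .deliver ⟨s, p, .ack S t⟩ ∨ X.event j = .deliver ⟨s, p, .nack S t⟩ := by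
    intro s hs
    obtain ⟨j, hj, S, he | he⟩ := hall s hs <;>
      have hans := ((hX j).sent _ (X.authentic j _ he hs) hs hp).1
    · exact ⟨j, hj, hans.1, hans.2.1, S, .inl he⟩
    · exact ⟨j, hj, hans.1, hans.2.1, S, .inr he⟩
  refine ⟨k, hk, by_contra fun hcon => ?_⟩
  push Not at hcon
  obtain ⟨hne, hts⟩ := hcon
  obtain ⟨hr, ht1⟩ : ((X.config (k + 1)).proposer p).phase.rank = 2 ∧ 1 ≤ t := by
    obtain ⟨j, hj, h1, h2, -⟩ := htj p hp
    have hle := (advance hX hp (hj.trans (k.le_add_right 1))).ts_le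
    have := hpos (h1.trans (h2.trans hle))
    have := Phase.rank_le ((X.config (k + 1)).proposer p).phase
    exact ⟨by omega, h1⟩
  replace hts := hts hr.ge
  have hlt := ((hX (k + 1)).settled p hp).proposing hr
  -- With `ts` stuck at `t`, every answer arrived while it was current. A nack would have raised
  -- `ts`, so all were acks, and `Ack_set` was not reset since.
  have hsub : Finset.univ \ F ⊆ ((X.config (k + 1)).proposer p).ackSet := by
    intro s hs
    replace hs : s ∉ F := by simpa using hs
    obtain ⟨j, hj, -, h2, S, he⟩ := htj s hs
    have hadv := advance hX hp (hj.trans (k.le_add_right 1))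
    have hadv' := advance hX hp (Nat.add_le_add_right hj 1)
    have htj : t = ((X.config j).proposer p).ts := by
      have := hadv.ts_le
      omega
    have hrj : ((X.config j).proposer p).phase.rank = 2 := by
      have := hadv.rank
      have := hpos (j := j) (by omega)
      omega
    have hbyz : s ∉ ((X.config j).proposer p).byz := fun hb => hs (((hX j).proposer p hp).byz hb)
    rw [htj] at he
    rcases he with he | he <;> have hans := ((hX j).sent _ (X.authentic j _ he hs) hs hp).1
    · have hmem := proposerReceive_ack hrj hbyz hans
      rw [← X.proposer_succ he hp] at hmem
      rcases hadv'.ts with hlt | ⟨-, -, hle⟩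
      · have := (advance hX hp (j.le_add_right 1)).ts_le
        omega
      · exact hle hmem
    · have hlt := proposerReceive_nack hrj hbyz hans
      rw [← X.proposer_succ he hp] at hlt
      have := hadv'.ts_le
      dsimp only at hlt
      omega
  have hc := Finset.card_le_card hsub
  rw [card_correct] at hc
  have := quorum_le hn hF
  omega

/-- A correct proposer refines its proposal at most `2 * f` times. -/
theorem Inv.ts_le {k : ℕ} (h : X.Inv k) (hF : F.card ≤ f) {p : Fin n} (hp : p ∉ F) :
    ((X.config k).proposer p).ts ≤ 2 * f + 1 := by
  have hP := h.proposer p hp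
  by_cases hr : 2 ≤ ((X.config k).proposer p).phase.rank
  · have h1 := hP.growth hr
    have h2 := hP.safe.card_values_le hF h.acceptor
    omega
  · have := (hP.early (by omega)).2
    omega

/-- Within `3 + 2m` delays the proposer has decided or reached timestamp `m + 1`. -/
theorem Deadline.exists_decided (hB : X.Deadline B) (hX : ∀ k, X.Inv k) (hn : 3 * f + 1 ≤ n)
    (hF : F.card ≤ f) (hpro : ∀ p, p ∉ F → pro p ∈ E) {p : Fin n} (hp : p ∉ F) :
    ∃ k, B (5 + 4 * f) k ∧ ((X.config (k + 1)).proposer p).phase.rank = 3 := by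
  have key : ∀ m, ∃ k, B (3 + 2 * m) k ∧ (((X.config (k + 1)).proposer p).phase.rank = 3 ∨
      ((X.config (k + 1)).proposer p).phase.rank = 2 ∧
        m + 1 ≤ ((X.config (k + 1)).proposer p).ts) := by
    intro m
    induction m with
    | zero =>
      obtain ⟨k, hk, h1⟩ := hB.exists_safetying hX hF hpro hp
      obtain ⟨k, hk, h2⟩ := hB.exists_proposing hX hn hF hp hk h1
      have := ((hX (k + 1)).proposer p hp).growth h2
      have := Phase.rank_le ((X.config (k + 1)).proposer p).phase
      exact ⟨k, hk, by omega⟩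
    | succ m ih =>
      obtain ⟨k, hk, h3 | ⟨h2, ht⟩⟩ := ih
      · exact ⟨k, hB.mono _ _ _ (by omega) hk, .inl h3⟩
      · obtain ⟨l, hl, h⟩ := hB.exists_refined hX hn hF hp hk h2
        have := Phase.rank_le ((X.config (l + 1)).proposer p).phase
        exact ⟨l, hl, by omega⟩
  -- This choice would need timestamp `2f + 2`, one above the maximum, and `3 + 2(2f + 1) = 5 + 4f`.
  obtain ⟨k, hk, h3 | ⟨-, ht⟩⟩ := key (2 * f + 1)
  · exact ⟨k, hB.mono _ _ _ (by omega) hk, h3⟩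
  · have := (hX (k + 1)).ts_le hF hp
    omega

theorem Deadline.exists_decidesAt (hB : X.Deadline B) (hn : 3 * f + 1 ≤ n) (hF : F.card ≤ f)
    (hpro : ∀ p, p ∉ F → pro p ∈ E) {p : Fin n} (hp : p ∉ F) :
    ∃ k, X.DecidesAt p k ∧ B (5 + 4 * f) k := by
  have hX := X.inv hF hpro
  obtain ⟨k, hk, h3⟩ := hB.exists_decided hX hn hF hpro hp
  have hex : ∃ i, ((X.config (i + 1)).proposer p).decision ≠ none := ⟨k, fun h => by
    have := ((hX (k + 1)).proposer p hp).decision.1 h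
    omega⟩
  -- `DecidesAt` singles out the event that switches the decision on, hence the least index; being
  -- no later than `k`, it inherits the deadline.
  refine ⟨Nat.find hex, ⟨?_, Option.ne_none_iff_exists'.1 (Nat.find_spec hex)⟩,
    hB.anti _ _ _ (Nat.find_min' hex fun h => ?_) hk⟩
  · rcases hi : Nat.find hex with _ | i
    · rw [X.config_zero]
      exact trigger_decision rfl
    · exact not_not.1 (Nat.find_min hex (m := i) (by omega))
  · have := ((hX (k + 1)).proposer p hp).decision.1 h
    omega

theorem deadline_true (X : Execution f E F pro) : X.Deadline fun _ _ => True where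
  init e he hd := (X.reliable_init e he hd).imp fun _ h => ⟨h, trivial⟩
  emitted _ k _ e he hd := (X.reliable k e he hd).imp fun _ h => ⟨h.2, trivial⟩
  mono _ _ _ _ _ := trivial
  anti _ _ _ _ _ := trivial

theorem DelaysAtMost.deadline {Δ : ℝ} (h : X.DelaysAtMost Δ) (hΔ : 0 ≤ Δ) :
    X.Deadline fun r j => X.time j ≤ r * Δ where
  init e he hd := (h.1 e he hd).imp fun _ h => ⟨h.1, by simpa using h.2⟩
  emitted r k hk e he hd := (h.2 k e he hd).imp fun _ h => ⟨h.2.1, by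
    push_cast
    linarith [h.2.2]⟩
  mono r r' j hr hj := hj.trans (by gcongr)
  anti r j j' hj h := (X.time_mono hj).trans h

/-- The initial message of `p` to itself arrives at a nonnegative time that is at most `Δ`. The sign
is needed for `r * Δ` to be monotone in `r`. -/
theorem DelaysAtMost.nonneg {Δ : ℝ} (h : X.DelaysAtMost Δ) {p : Fin n} (hp : p ∉ F) :
    0 ≤ Δ :=
  let ⟨j, _, hj⟩ := h.1 ⟨p, p, .initPhase ⟨pro p, p⟩⟩ ⟨hp, List.mem_cons_self⟩ hp
  (X.time_nonneg j).trans hj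

end Execution

end SbS

end

theorem mainTheorem9 {V : Type*} (n f : ℕ) (hn : 3 * f + 1 ≤ n) (E : Set V)
    (F : Finset (Fin n)) (hF : F.card ≤ f) (pro : Fin n → V) (hpro : ∀ p, p ∉ F → pro p ∈ E)
    (X : SbS.Execution f E F pro) (p : Fin n) (hp : p ∉ F) :
    (∃ k, X.DecidesAt p k) ∧
      ∀ Δ : ℝ, X.DelaysAtMost Δ → ∃ k, X.DecidesAt p k ∧ X.time k ≤ (5 + 4 * (f : ℝ)) * Δ := by
  constructor
  · obtain ⟨k, hk, -⟩ := X.deadline_true.exists_decidesAt hn hF hpro hp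
    exact ⟨k, hk⟩
  · intro Δ hΔ
    obtain ⟨k, hk, ht⟩ := (hΔ.deadline (hΔ.nonneg hp)).exists_decidesAt hn hF hpro hp
    exact ⟨k, hk, by exact_mod_cast ht⟩
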